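/- A tournament $T=(V,A)$ is a finite set $V$ of vertices with a set $A$ of ordered pairs of distinct vertices (arcs) such that, for all $x\neq y$ in $V$, exactly one of $(x,y)$, $(y,x)$ belongs to $A$. Its dual $T^{*}$ is obtained by reversing all arcs; $T[X]$ denotes the subtournament induced by $X\subseteq V$. A tournament is self dual if it is isomorphic to its dual; $T$ is $\{-3\}$-self dual if $T[V\setminus X]$ is self dual for every set $X\subseteq V$ of exactly $3$ vertices, and strongly self dual if $T[X]$ is self dual for every $X\subseteq V$. A set $I\subseteq V$ is an interval of $T$ if every vertex outside $I$ either dominates all elements of $I$ or is dominated by all elements of $I$ (where $x$ dominates $y$ if $(x,y)\in A$); $T$ is decomposable if it has an interval other than $\emptyset$, the singletons and $V$. $T$ is transitive if $(x,y),(y,z)\in A$ implies $(x,z)\in A$; it is almost transitive if it is obtained from a transitive tournament with at least three vertices by reversing the arc between its two extremal vertices (the vertex dominating all the others and the vertex dominated by all the others). Theorem. Let $T$ be a decomposable tournament with at least $9$ vertices. Then $T$ is $\{-3\}$-self dual if and only if $T$ is transitive or almost transitive. Moreover, $T$ is $\{-3\}$-self dual if and only if it is strongly self dual. -/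

import Mathlib

/-- A tournament on the vertex set `V`: between two distinct vertices there is exactly one arc, and
there are no loops. `T.Adj x y` means that `(x, y)` is an arc, i.e. `x` dominates `y`. -/
structure Tournament (V : Type*) extends Digraph V where
  loopless : ∀ x, ¬ Adj x x
  adj_iff : ∀ x y, x ≠ y → (Adj x y ↔ ¬ Adj y x)

namespace Tournament

/-- The dual tournament, obtained by reversing all arcs. -/
def dual {V : Type*} (T : Tournament V) : Tournament V where
  Adj x y := T.Adj y x
  loopless := T.loopless
  adj_iff x y h := T.adj_iff y x h.symm

/-- The subtournament `T[X]` induced by a set `X` of vertices. -/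
def induce {V : Type*} (T : Tournament V) (X : Set V) : Tournament X where
  Adj x y := T.Adj x y
  loopless x := T.loopless x
  adj_iff x y h := T.adj_iff x y (fun e => h (Subtype.ext e))

/-- Two tournaments are isomorphic: some bijection of the vertex sets preserves and reflects
the arcs. -/
def Isomorphic {V W : Type*} (T : Tournament V) (T' : Tournament W) : Prop :=
  Nonempty (T.Adj ≃r T'.Adj)

/-- A tournament is self dual if it is isomorphic to its dual. -/
def IsSelfDual {V : Type*} (T : Tournament V) : Prop :=
  T.Isomorphic T.dual

/-- `T` is `{-k}`-self dual: deleting any `k` vertices leaves a self dual subtournament. -/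
def IsMinusSelfDual {V : Type*} (T : Tournament V) (k : ℕ) : Prop :=
  ∀ X : Finset V, X.card = k → (T.induce (X : Set V)ᶜ).IsSelfDual

/-- `T` is strongly self dual: `T[X]` and `T*[X]` are isomorphic for every set `X` of vertices. -/
def IsStronglySelfDual {V : Type*} (T : Tournament V) : Prop :=
  ∀ X : Set V, (T.induce X).Isomorphic (T.dual.induce X)

/-- `I` is an interval of `T`: every vertex outside `I` dominates all elements of `I` or is
dominated by all elements of `I`. -/
def IsInterval {V : Type*} (T : Tournament V) (I : Set V) : Prop :=
  ∀ x, x ∉ I → (∀ a ∈ I, T.Adj x a) ∨ (∀ a ∈ I, T.Adj a x)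

/-- `T` is indecomposable: its only intervals are the empty set, the singletons and the whole
vertex set. -/
def IsIndecomposable {V : Type*} (T : Tournament V) : Prop :=
  ∀ I : Set V, T.IsInterval I → I = ∅ ∨ (∃ x, I = {x}) ∨ I = Set.univ

/-- `T` is decomposable: it is not indecomposable. -/
def IsDecomposable {V : Type*} (T : Tournament V) : Prop :=
  ¬ T.IsIndecomposable

/-- `T` is transitive (a linear order). -/
def IsTransitive {V : Type*} (T : Tournament V) : Prop :=
  ∀ x y z, T.Adj x y → T.Adj y z → T.Adj x z

open Classical in
/-- The tournament obtained from `T` by reversing the arc between `a` and `b`. -/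
def reverseArc {V : Type*} (T : Tournament V) (a b : V) : Tournament V where
  Adj x y := if (x = a ∧ y = b) ∨ (x = b ∧ y = a) then T.Adj y x else T.Adj x y
  loopless x := by
    have h := T.loopless x
    split_ifs <;> exact h
  adj_iff x y h := by
    have h1 := T.adj_iff x y h
    have h2 := T.adj_iff y x h.symm
    by_cases hx : (x = a ∧ y = b) ∨ (x = b ∧ y = a)
    · have hy : (y = a ∧ x = b) ∨ (y = b ∧ x = a) := by tauto
      simpa only [if_pos hx, if_pos hy] using h2
    · have hy : ¬ ((y = a ∧ x = b) ∨ (y = b ∧ x = a)) := by tauto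
      simpa only [if_neg hx, if_neg hy] using h1

/-- `T` is almost transitive: it is obtained from a transitive tournament `S` with at least three
vertices by reversing the arc formed by the two extremal vertices of `S`, the vertex `a` that
dominates all others and the vertex `b` that is dominated by all others. -/
def IsAlmostTransitive {V : Type*} [Fintype V] (T : Tournament V) : Prop :=
  3 ≤ Fintype.card V ∧ ∃ S : Tournament V, S.IsTransitive ∧
    ∃ a b : V, (∀ x, x ≠ a → S.Adj a x) ∧ (∀ x, x ≠ b → S.Adj x b) ∧ T = S.reverseArc a b

end Tournament

/-!
A `{-3}`-self dual tournament `T` on `n ≥ 9` vertices contains, through every set `X` of at most three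
vertices, as many copies of a tournament `H` as of its dual, provided `|H| ≤ n - 3`
(`exists_reversed_copy`). Applied to patterns with four and five vertices this is a strong local
restriction: proper intervals are transitive, so a decomposable `T` has twins, and twins force `T` to
be locally transitive (`isLocallyTransitive_of_twins`). Around any vertex `x`, such a `T` consists of
two transitive sets, the in-neighbourhood `N` and its complement `M`, joined by monotone arcs.

Let `x` have maximum out-degree, and let `X ⊆ N` have three elements. If every other vertex of maximum
out-degree is in `X` or dominates an element of `X`, then `x` is the only vertex of maximum out-degree
in `T - X`. An anti-automorphism of `T - X` then preserves `N \ X` and `M`, so that the arcs between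
them are balanced (`sum_sdiff_eq_zero`). When `|N| ≥ 4`, varying `X` shows that every vertex of `N`
dominates exactly half of `M`; so `T` is a cyclic triple `A → B → N → A` of transitive parts with
`|A| = |B| ≥ |N|`, and deleting one vertex of `A` and two of `N` contradicts self duality
(`card_inn_le_three`).

When `|N| ≤ 3`, consider a vertex `c` of `N` and the parts `A → B` of `M` with `B → c → A`. If both
had two or more elements, they could be trimmed to different sizes, and then `c`, as the only vertex
on all `3`-cycles, would be fixed by an anti-automorphism exchanging parts of different sizes
(`no_three_part_cycle`). Hence one part is a singleton, and degree considerations leave only the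
transitive and the almost transitive tournaments.

Conversely, the order reversal of a transitive tournament exchanges the first and last vertices, so it
remains an anti-automorphism after reversing the arc between them.
-/

namespace Tournament

/-! ### Anti-automorphisms and the counting principle -/

theorem ne_of_adj {V : Type*} (T : Tournament V) {x y : V} (h : T.Adj x y) : x ≠ y := by
  rintro rfl
  exact T.loopless _ h

theorem asymm {V : Type*} (T : Tournament V) {x y : V} (h : T.Adj x y) : ¬ T.Adj y x :=
  (T.adj_iff x y (T.ne_of_adj h)).1 h

theorem total {V : Type*} (T : Tournament V) {x y : V} (h : x ≠ y) : T.Adj x y ∨ T.Adj y x := by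
  have := T.adj_iff x y h
  tauto

/-- The injection `σ` reverses all arcs of `T` between vertices of `S`; one direction suffices, as
two distinct vertices of a tournament span exactly one arc. -/
def ReversesOn {V : Type*} (T : Tournament V) (σ : Equiv.Perm V) (S : Finset V) : Prop :=
  ∀ u ∈ S, ∀ v ∈ S, T.Adj u v → T.Adj (σ v) (σ u)

theorem ReversesOn.adj_iff {V : Type*} {T : Tournament V} {σ : Equiv.Perm V} {S : Finset V}
    (h : T.ReversesOn σ S) {u v : V} (hu : u ∈ S) (hv : v ∈ S) :
    T.Adj (σ v) (σ u) ↔ T.Adj u v := by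
  refine ⟨fun huv => ?_, h u hu v hv⟩
  have hne : u ≠ v := by
    rintro rfl
    exact T.loopless _ huv
  rcases T.total hne with h1 | h1
  · exact h1
  · exact absurd (h v hv u hu h1) (T.asymm huv)

/-- An anti-automorphism of the subtournament on `W`, extended to a permutation of all vertices. -/
theorem IsMinusSelfDual.exists_perm {V : Type*} [Fintype V] {T : Tournament V} {k : ℕ}
    (h : T.IsMinusSelfDual k)
    {W : Finset V} (hW : W.card + k = Fintype.card V) :
    ∃ σ : Equiv.Perm V, (∀ v, σ v ∈ W ↔ v ∈ W) ∧ T.ReversesOn σ W := by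
  classical
  have hc : (Wᶜ).card = k := by
    rw [Finset.card_compl]
    omega
  obtain ⟨e⟩ := h Wᶜ hc
  have hmem : ∀ v, v ∈ ((Wᶜ : Finset V) : Set V)ᶜ ↔ v ∈ W := by simp
  have key : ∀ v (hv : v ∈ ((Wᶜ : Finset V) : Set V)ᶜ),
      Equiv.Perm.ofSubtype (p := fun v => v ∈ ((Wᶜ : Finset V) : Set V)ᶜ) e.toEquiv v
        = e ⟨v, hv⟩ := fun v hv => Equiv.Perm.ofSubtype_apply_of_mem _ hv
  refine ⟨Equiv.Perm.ofSubtype (p := fun v => v ∈ ((Wᶜ : Finset V) : Set V)ᶜ) e.toEquiv,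
    fun v => ?_, fun u hu v hv huv => ?_⟩
  · by_cases hv : v ∈ W
    · rw [key v ((hmem v).2 hv)]
      exact iff_of_true ((hmem _).1 (e ⟨v, _⟩).2) hv
    · rw [Equiv.Perm.ofSubtype_apply_of_not_mem _ (fun h' => hv ((hmem v).1 h'))]
  · rw [key v ((hmem v).2 hv), key u ((hmem u).2 hu)]
    have : (T.induce (((Wᶜ : Finset V) : Set V)ᶜ)).Adj ⟨u, (hmem u).2 hu⟩ ⟨v, (hmem v).2 hv⟩ := huv
    exact e.map_rel_iff.2 this

open Classical in
/-- Averaging: if a function supported on `s`-subsets has total zero inside every `w`-subset, where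
`s ≤ w`, then it has total zero inside every larger subset. -/
theorem sum_powerset_eq_zero {V : Type*} {f : Finset V → ℤ} {s w : ℕ} (hsw : s ≤ w)
    (hf : ∀ S, S.card ≠ s → f S = 0)
    (h0 : ∀ W : Finset V, W.card = w → ∑ S ∈ W.powerset, f S = 0) :
    ∀ (j : ℕ) (W : Finset V), W.card = w + j → ∑ S ∈ W.powerset, f S = 0 := by
  intro j
  induction j with
  | zero => exact fun W hW => h0 W (by simpa using hW)
  | succ j ih =>
    intro W hW
    have h1 : ∑ v ∈ W, ∑ S ∈ (W.erase v).powerset, f S = 0 :=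
      Finset.sum_eq_zero fun v hv => ih _ (by rw [Finset.card_erase_of_mem hv]; omega)
    have h2 : ∀ v ∈ W, ∑ S ∈ (W.erase v).powerset, f S
        = ∑ S ∈ W.powerset, if v ∉ S then f S else 0 := by
      intro v _
      rw [← Finset.sum_filter]
      refine Finset.sum_congr ?_ fun _ _ => rfl
      ext S
      simp only [Finset.mem_powerset, Finset.mem_filter, Finset.subset_erase]
    rw [Finset.sum_congr rfl h2, Finset.sum_comm] at h1
    have h3 : ∀ S ∈ W.powerset, (∑ v ∈ W, if v ∉ S then f S else 0)
        = ((w + j + 1 - s : ℕ) : ℤ) * f S := by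
      intro S hS
      rw [← Finset.sum_filter, Finset.sum_const, nsmul_eq_mul]
      by_cases hs : S.card = s
      · have : W.filter (fun v => v ∉ S) = W \ S := by
          ext; simp
        rw [this, Finset.card_sdiff_of_subset (Finset.mem_powerset.1 hS), hW, hs]
        rfl
      · rw [hf S hs]; simp
    rw [Finset.sum_congr rfl h3, ← Finset.mul_sum] at h1
    rcases mul_eq_zero.1 h1 with h4 | h4
    · exact absurd h4 (by norm_cast; omega)
    · exact h4

open Classical in
/-- Inclusion-exclusion: if `f` has total zero inside every set missing at most `k` vertices, then the
sets containing a given `Y` with `|Y| ≤ k` also have total zero. -/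
theorem sum_powerset_superset_eq_zero {V : Type*} [Fintype V] {f : Finset V → ℤ} {k : ℕ}
    (h0 : ∀ W : Finset V, Fintype.card V ≤ W.card + k → ∑ S ∈ W.powerset, f S = 0)
    (Y : Finset V) : ∀ W : Finset V, Y ⊆ W → Fintype.card V + Y.card ≤ W.card + k →
      ∑ S ∈ W.powerset with Y ⊆ S, f S = 0 := by
  induction Y using Finset.induction_on with
  | empty =>
    intro W _ h
    simpa using h0 W (by simpa using h)
  | insert v Y hv ih =>
    intro W hYW h
    rw [Finset.card_insert_of_notMem hv] at h
    have hvW : v ∈ W := hYW (Finset.mem_insert_self v Y)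
    have hY : Y ⊆ W := (Finset.subset_insert v Y).trans hYW
    have h1 := ih W hY (by omega)
    have h2 := ih (W.erase v) (by
      rw [Finset.subset_erase]; exact ⟨hY, hv⟩) (by
      rw [Finset.card_erase_of_mem hvW]
      have := Finset.card_pos.2 ⟨v, hvW⟩
      omega)
    rw [← Finset.sum_filter_add_sum_filter_not _ (fun S => v ∈ S)] at h1
    have e1 : ((W.powerset.filter (fun S => Y ⊆ S)).filter (fun S => v ∈ S))
        = W.powerset.filter (fun S => insert v Y ⊆ S) := by
      ext S
      simp only [Finset.mem_filter, Finset.insert_subset_iff]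
      tauto
    have e2 : ((W.powerset.filter (fun S => Y ⊆ S)).filter (fun S => v ∉ S))
        = (W.erase v).powerset.filter (fun S => Y ⊆ S) := by
      ext S
      simp only [Finset.mem_filter, Finset.mem_powerset, Finset.subset_erase]
      tauto
    rw [e1, e2, h2, add_zero] at h1
    exact h1

open Classical in
/-- The counting principle behind the local analysis: a set `X` of at most `k` vertices that lies in
a copy `S₀` of a small tournament also lies in a copy of its dual. Indeed `T` minus any `k` vertices
contains as many copies of `T[S₀]` as of its dual, and by inclusion-exclusion the same holds for
the copies that contain `X`. -/
theorem IsMinusSelfDual.exists_reversed_copy {V : Type*} [Fintype V] {T : Tournament V}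
    {k : ℕ} (h : T.IsMinusSelfDual k)
    {S₀ X : Finset V} (hX : X ⊆ S₀) (hXk : X.card ≤ k) (hS : S₀.card + k ≤ Fintype.card V) :
    ∃ σ : Equiv.Perm V, (∀ x ∈ X, ∃ u ∈ S₀, σ u = x) ∧ T.ReversesOn σ S₀ := by
  let P : Finset V → Prop := fun S => ∃ σ : Equiv.Perm V, S₀.map σ.toEmbedding = S ∧
    ∀ u ∈ S₀, ∀ v ∈ S₀, T.Adj u v → T.Adj (σ u) (σ v)
  let Q : Finset V → Prop := fun S => ∃ σ : Equiv.Perm V, S₀.map σ.toEmbedding = S ∧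
    T.ReversesOn σ S₀
  let f : Finset V → ℤ := fun S => (if P S then 1 else 0) - (if Q S then 1 else 0)
  have hf : ∀ S, S.card ≠ S₀.card → f S = 0 := by
    intro S hSc
    have h1 : ¬ P S := by
      rintro ⟨σ, rfl, -⟩
      simp at hSc
    have h2 : ¬ Q S := by
      rintro ⟨σ, rfl, -⟩
      simp at hSc
    simp [f, h1, h2]
  have h0 : ∀ W : Finset V, W.card = Fintype.card V - k → ∑ S ∈ W.powerset, f S = 0 := by
    intro W hW
    obtain ⟨τ, hτ, hrev⟩ := h.exists_perm (W := W) (by omega)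
    simp only [f, Finset.sum_sub_distrib]
    rw [sub_eq_zero]
    refine Finset.sum_bij (fun S _ => S.map τ.toEmbedding) ?_ ?_ ?_ ?_
    · intro S hS
      rw [Finset.mem_powerset] at hS ⊢
      intro v hv
      obtain ⟨u, hu, rfl⟩ := Finset.mem_map.1 hv
      exact (hτ u).2 (hS hu)
    · intro S _ S' _ he
      exact Finset.map_injective _ he
    · intro S hS
      rw [Finset.mem_powerset] at hS
      refine ⟨S.map τ.symm.toEmbedding, ?_, ?_⟩
      · rw [Finset.mem_powerset]
        intro v hv
        obtain ⟨u, hu, rfl⟩ := Finset.mem_map.1 hv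
        have := hS hu
        rw [← hτ]
        simpa using this
      · ext v
        simp
    · intro S hS
      rw [Finset.mem_powerset] at hS
      have : P S ↔ Q (S.map τ.toEmbedding) := by
        constructor
        · rintro ⟨σ, rfl, hσ⟩
          refine ⟨σ.trans τ, by rw [Finset.map_map]; rfl, fun u hu v hv huv => ?_⟩
          exact hrev _ (hS (Finset.mem_map_of_mem _ hu)) _ (hS (Finset.mem_map_of_mem _ hv))
            (hσ u hu v hv huv)
        · rintro ⟨σ, hσS, hσ⟩
          have hS' : S₀.map (σ.trans τ.symm).toEmbedding = S := by
            apply Finset.map_injective τ.toEmbedding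
            rw [← hσS, Finset.map_map]
            congr 1
            ext v
            simp
          refine ⟨σ.trans τ.symm, hS', fun u hu v hv huv => ?_⟩
          have hu' : τ.symm (σ u) ∈ W := hS (by rw [← hS']; exact Finset.mem_map_of_mem _ hu)
          have hv' : τ.symm (σ v) ∈ W := hS (by rw [← hS']; exact Finset.mem_map_of_mem _ hv)
          have := hrev.adj_iff hu' hv'
          simp only [Equiv.apply_symm_apply] at this
          exact this.1 (hσ u hu v hv huv)
      simp only [this]
  have h1 : ∀ W : Finset V, Fintype.card V ≤ W.card + k → ∑ S ∈ W.powerset, f S = 0 := by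
    intro W hW
    exact sum_powerset_eq_zero (s := S₀.card) (w := Fintype.card V - k) (by omega) hf h0
      (W.card - (Fintype.card V - k)) W (by omega)
  have h2 := sum_powerset_superset_eq_zero h1 X Finset.univ (Finset.subset_univ _)
    (by rw [Finset.card_univ]; omega)
  by_contra hno
  have hQ : ∀ S, X ⊆ S → ¬ Q S := by
    rintro S hXS ⟨σ, rfl, hσ⟩
    refine hno ⟨σ, fun x hx => ?_, hσ⟩
    obtain ⟨u, hu, rfl⟩ := Finset.mem_map.1 (hXS hx)
    exact ⟨u, hu, rfl⟩
  have h3 : ∀ S ∈ (Finset.univ : Finset V).powerset.filter (fun S => X ⊆ S),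
      0 ≤ f S := by
    intro S hS
    have := hQ S (Finset.mem_filter.1 hS).2
    simp only [f, this, if_false, sub_zero]
    split_ifs <;> simp
  have h4 := (Finset.sum_eq_zero_iff_of_nonneg h3).1 h2 S₀ (by simp [hX])
  have hP : P S₀ := ⟨Equiv.refl V, by ext; simp, fun u _ v _ huv => huv⟩
  simp [f, hP, hQ S₀ hX] at h4

/-! ### Transitive sets and intervals -/

/-- `T` is transitive on the set `S` of vertices. -/
def TransOn {V : Type*} (T : Tournament V) (S : Set V) : Prop :=
  ∀ x ∈ S, ∀ y ∈ S, ∀ z ∈ S, T.Adj x y → T.Adj y z → T.Adj x z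

theorem transOn_of_no_cycle {V : Type*} {T : Tournament V} {S : Set V}
    (h : ∀ p ∈ S, ∀ q ∈ S, ∀ r ∈ S, T.Adj p q → T.Adj q r → ¬ T.Adj r p) : T.TransOn S := by
  intro x hx y hy z hz hxy hyz
  have hne : x ≠ z := by
    rintro rfl
    exact T.asymm hxy hyz
  exact (T.total hne).resolve_right (h x hx y hy z hz hxy hyz)

/-- A transitive triple `a → b → c` inside a `3`-cycle `p, q, r` plus a source `s` has first vertex
`s`, and the fourth vertex closes the arc `(b, c)` to the `3`-cycle. -/
theorem fourth_of_source {V : Type*} {T : Tournament V} {a b c p q r s : V}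
    (hpq : T.Adj p q) (hqr : T.Adj q r) (hrp : T.Adj r p)
    (hsp : T.Adj s p) (hsq : T.Adj s q) (hsr : T.Adj s r)
    (ha : a = p ∨ a = q ∨ a = r ∨ a = s) (hb : b = p ∨ b = q ∨ b = r ∨ b = s)
    (hc : c = p ∨ c = q ∨ c = r ∨ c = s)
    (hab : T.Adj a b) (hbc : T.Adj b c) (hac : T.Adj a c) :
    ∃ e, T.Adj a e ∧ T.Adj c e ∧ T.Adj e b := by
  have h1 := fun x y => T.asymm (x := x) (y := y)
  have h2 := T.loopless
  rcases ha with rfl | rfl | rfl | rfl <;> rcases hb with rfl | rfl | rfl | rfl <;>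
    rcases hc with rfl | rfl | rfl | rfl <;> grind

/-- A transitive triple lying in a `3`-cycle with a sink also lies in a `3`-cycle with a source; `e`
is the fourth vertex of the latter. -/
theorem exists_fourth_of_sink {V : Type*} [Fintype V] {T : Tournament V}
    (h : T.IsMinusSelfDual 3) (hn : 7 ≤ Fintype.card V) {p q r s a b c : V}
    (hpq : T.Adj p q) (hqr : T.Adj q r) (hrp : T.Adj r p)
    (hps : T.Adj p s) (hqs : T.Adj q s) (hrs : T.Adj r s)
    (ha : a = p ∨ a = q ∨ a = r ∨ a = s) (hb : b = p ∨ b = q ∨ b = r ∨ b = s)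
    (hc : c = p ∨ c = q ∨ c = r ∨ c = s)
    (hab : T.Adj a b) (hbc : T.Adj b c) (hac : T.Adj a c) :
    ∃ e, T.Adj a e ∧ T.Adj c e ∧ T.Adj e b := by
  classical
  obtain ⟨σ, hX, hσ⟩ := h.exists_reversed_copy (S₀ := {p, q, r, s}) (X := {a, b, c})
    (by
      intro v hv
      simp only [Finset.mem_insert, Finset.mem_singleton] at hv ⊢
      rcases hv with rfl | rfl | rfl <;> assumption)
    Finset.card_le_three (by have := Finset.card_le_four (a := p) (b := q) (c := r) (d := s); omega)
  have key : ∀ x, x ∈ ({a, b, c} : Finset V) → x = σ r ∨ x = σ q ∨ x = σ p ∨ x = σ s := by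
    intro x hx
    obtain ⟨u, hu, rfl⟩ := hX x hx
    simp only [Finset.mem_insert, Finset.mem_singleton] at hu
    rcases hu with rfl | rfl | rfl | rfl <;> simp
  have m : ∀ u v, u ∈ ({p, q, r, s} : Finset V) → v ∈ ({p, q, r, s} : Finset V) → T.Adj u v →
      T.Adj (σ v) (σ u) := fun u v hu hv => hσ u hu v hv
  exact fourth_of_source (m q r (by simp) (by simp) hqr) (m p q (by simp) (by simp) hpq)
    (m r p (by simp) (by simp) hrp) (m r s (by simp) (by simp) hrs) (m q s (by simp) (by simp) hqs)
    (m p s (by simp) (by simp) hps)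
    (key a (by simp)) (key b (by simp)) (key c (by simp)) hab hbc hac

theorem IsSelfDual.dual {V : Type*} {T : Tournament V} (h : T.IsSelfDual) : T.dual.IsSelfDual := by
  obtain ⟨e⟩ := h
  exact ⟨⟨e.toEquiv, fun {x y} => e.map_rel_iff (a := y) (b := x)⟩⟩

theorem IsMinusSelfDual.dual {V : Type*} {T : Tournament V} {k : ℕ} (h : T.IsMinusSelfDual k) :
    T.dual.IsMinusSelfDual k :=
  fun X hX => (h X hX).dual

theorem exists_fourth_of_source {V : Type*} [Fintype V] {T : Tournament V}
    (h : T.IsMinusSelfDual 3) (hn : 7 ≤ Fintype.card V) {p q r s a b c : V}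
    (hpq : T.Adj p q) (hqr : T.Adj q r) (hrp : T.Adj r p)
    (hsp : T.Adj s p) (hsq : T.Adj s q) (hsr : T.Adj s r)
    (ha : a = p ∨ a = q ∨ a = r ∨ a = s) (hb : b = p ∨ b = q ∨ b = r ∨ b = s)
    (hc : c = p ∨ c = q ∨ c = r ∨ c = s)
    (hab : T.Adj a b) (hbc : T.Adj b c) (hac : T.Adj a c) :
    ∃ e, T.Adj e c ∧ T.Adj e a ∧ T.Adj b e :=
  exists_fourth_of_sink (T := T.dual) h.dual hn hrp hqr hpq hsp hsr hsq (by tauto) (by tauto)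
    (by tauto) hbc hab hac

/-- Proper intervals are transitive. A `3`-cycle in the interval together with an outside vertex `c`
has `c` as source or sink; moving to the dual pattern through `c` and two vertices of the cycle would
produce a vertex outside the interval that separates two of its elements. -/
theorem IsInterval.transOn {V : Type*} [Fintype V] {T : Tournament V}
    (h : T.IsMinusSelfDual 3) (hn : 7 ≤ Fintype.card V) {I : Set V} (hI : T.IsInterval I)
    (hne : I ≠ Set.univ) : T.TransOn I := by
  obtain ⟨c, hc⟩ := (Set.ne_univ_iff_exists_notMem I).1 hne
  refine transOn_of_no_cycle fun p hp q hq r hr hpq hqr hrp => ?_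
  have as := fun x y => T.asymm (x := x) (y := y)
  rcases hI c hc with h1 | h1
  · obtain ⟨e, he1, he2, he3⟩ := exists_fourth_of_source h hn hpq hqr hrp (h1 p hp) (h1 q hq)
      (h1 r hr) (a := c) (b := p) (c := q) (by simp) (by simp) (by simp) (h1 p hp) hpq (h1 q hq)
    by_cases heI : e ∈ I
    · exact as _ _ he2 (h1 e heI)
    · rcases hI e heI with h2 | h2
      · exact as _ _ he3 (h2 p hp)
      · exact as _ _ he1 (h2 q hq)
  · obtain ⟨e, he1, he2, he3⟩ := exists_fourth_of_sink h hn hpq hqr hrp (h1 p hp) (h1 q hq)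
      (h1 r hr) (a := p) (b := q) (c := c) (by simp) (by simp) (by simp) hpq (h1 q hq) (h1 p hp)
    by_cases heI : e ∈ I
    · exact as _ _ he2 (h1 e heI)
    · rcases hI e heI with h2 | h2
      · exact as _ _ he1 (h2 p hp)
      · exact as _ _ he3 (h2 q hq)

/-! ### First and last vertices of transitive sets, and twins -/

/-- A finite nonempty set on which `T` is transitive has a first vertex. -/
theorem TransOn.exists_first {V : Type*} {T : Tournament V} {A : Finset V}
    (hA : T.TransOn A) (hne : A.Nonempty) : ∃ y ∈ A, ∀ a ∈ A, a ≠ y → T.Adj y a := by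
  classical
  induction hne using Finset.Nonempty.cons_induction with
  | singleton a => exact ⟨a, by simp, by simp⟩
  | cons a s ha hs ih =>
    have hmem : ∀ x ∈ s, x ∈ ((Finset.cons a s ha : Finset V) : Set V) := fun x hx => by simp [hx]
    obtain ⟨y, hy, hys⟩ := ih fun x hx z hz w hw => hA x (hmem x hx) z (hmem z hz) w (hmem w hw)
    have hay : a ≠ y := by
      rintro rfl
      exact ha hy
    rcases T.total hay with h1 | h1
    · refine ⟨a, by simp, fun b hb hba => ?_⟩
      rcases Finset.mem_cons.1 hb with rfl | hb
      · exact absurd rfl hba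
      · by_cases hby : b = y
        · rwa [hby]
        · exact hA a (by simp) y (hmem y hy) b (hmem b hb) h1 (hys b hb hby)
    · refine ⟨y, by simp [hy], fun b hb hba => ?_⟩
      rcases Finset.mem_cons.1 hb with rfl | hb
      · exact h1
      · exact hys b hb hba

theorem TransOn.dual {V : Type*} {T : Tournament V} {S : Set V} (h : T.TransOn S) :
    T.dual.TransOn S :=
  fun x hx y hy z hz hxy hyz => h z hz y hy x hx hyz hxy

theorem TransOn.mono {V : Type*} {T : Tournament V} {S R : Set V} (h : T.TransOn S) (hR : R ⊆ S) :
    T.TransOn R :=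
  fun x hx y hy z hz => h x (hR hx) y (hR hy) z (hR hz)

theorem TransOn.exists_last {V : Type*} {T : Tournament V} {A : Finset V}
    (hA : T.TransOn A) (hne : A.Nonempty) : ∃ y ∈ A, ∀ a ∈ A, a ≠ y → T.Adj a y :=
  hA.dual.exists_first hne

/-- A decomposable tournament satisfying the hypotheses has twins: the first two vertices of a
nontrivial (hence transitive) interval. -/
theorem exists_twins {V : Type*} [Fintype V] {T : Tournament V}
    (h : T.IsMinusSelfDual 3) (hn : 7 ≤ Fintype.card V) (hdec : T.IsDecomposable) :
    ∃ a b, T.Adj a b ∧ ∀ x, x ≠ a → x ≠ b → (T.Adj x a ↔ T.Adj x b) := by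
  classical
  simp only [IsDecomposable, IsIndecomposable, not_forall, not_or, not_exists] at hdec
  obtain ⟨I, hI, h0, h1, h2⟩ := hdec
  have ht := hI.transOn h hn h2
  obtain ⟨a, ha, hfa⟩ := TransOn.exists_first (A := I.toFinset) (by simpa using ht)
    (by simpa using Set.nonempty_iff_ne_empty.2 h0)
  simp only [Set.mem_toFinset] at ha hfa
  obtain ⟨b, hb, hfb⟩ := TransOn.exists_first (T := T) (A := I.toFinset.erase a)
    (ht.mono fun x hx => by simpa using Finset.mem_of_mem_erase hx) (by
      by_contra hcon
      rw [Finset.not_nonempty_iff_eq_empty] at hcon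
      refine h1 a (Set.eq_singleton_iff_unique_mem.2 ⟨ha, fun x hx => ?_⟩)
      by_contra hxa
      have : x ∈ I.toFinset.erase a := by simp [hx, hxa]
      simp [hcon] at this)
  simp only [Finset.mem_erase, Set.mem_toFinset] at hb hfb
  refine ⟨a, b, hfa b hb.2 hb.1, fun x hxa hxb => ?_⟩
  by_cases hx : x ∈ I
  · exact iff_of_false (T.asymm (hfa x hx hxa)) (T.asymm (hfb x ⟨hxa, hx⟩ hxb))
  · rcases hI x hx with h3 | h3
    · exact iff_of_true (h3 a ha) (h3 b hb.2)
    · exact iff_of_false (T.asymm (h3 a ha)) (T.asymm (h3 b hb.2))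

/-- In a `3`-cycle `p, q, r` dominating two further vertices `s`, `t`, only `s` and `t` can be twins,
so twins are dominated by all the other vertices. -/
theorem dominates_of_twins {V : Type*} {T : Tournament V} {a b c p q r s t : V}
    (hpq : T.Adj p q) (hqr : T.Adj q r) (hrp : T.Adj r p)
    (hps : T.Adj p s) (hqs : T.Adj q s) (hrs : T.Adj r s)
    (hpt : T.Adj p t) (hqt : T.Adj q t) (hrt : T.Adj r t)
    (htw : ∀ x, x ≠ a → x ≠ b → (T.Adj x a ↔ T.Adj x b)) (hab : a ≠ b) (hac : a ≠ c) (hbc : b ≠ c)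
    (ha : a = p ∨ a = q ∨ a = r ∨ a = s ∨ a = t) (hb : b = p ∨ b = q ∨ b = r ∨ b = s ∨ b = t)
    (hc : c = p ∨ c = q ∨ c = r ∨ c = s ∨ c = t) : T.Adj c a := by
  have as := fun x y => T.asymm (x := x) (y := y)
  have ne := fun x y => T.ne_of_adj (x := x) (y := y)
  have hp := htw p
  have hq := htw q
  have hr := htw r
  clear htw
  rcases ha with rfl | rfl | rfl | rfl | rfl <;> rcases hb with rfl | rfl | rfl | rfl | rfl <;>
    grind

/-- A `3`-cycle dominated by twins would, by passing to the dual `5`-vertex pattern containing the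
twins and a vertex `c` of the cycle, force `c` to dominate the twins. -/
theorem twins_out_transOn {V : Type*} [Fintype V] {T : Tournament V}
    (h : T.IsMinusSelfDual 3) (hn : 8 ≤ Fintype.card V) {a b : V} (hab : T.Adj a b)
    (htw : ∀ x, x ≠ a → x ≠ b → (T.Adj x a ↔ T.Adj x b)) : T.TransOn {x | T.Adj a x} := by
  classical
  have hout : ∀ x, T.Adj a x → x ≠ b → T.Adj b x := by
    intro x hax hxb
    refine (T.total hxb.symm).resolve_right fun hx => ?_
    exact T.asymm hax ((htw x (T.ne_of_adj hax).symm hxb).2 hx)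
  refine transOn_of_no_cycle ?_
  intro c hac d had e hae hcd hde hec
  simp only [Set.mem_ofPred_eq] at hac had hae
  have hcb : c ≠ b := by
    rintro rfl
    exact T.asymm hec (hout e hae (T.ne_of_adj hec))
  have hdb : d ≠ b := by
    rintro rfl
    exact T.asymm hcd (hout c hac hcb)
  have heb : e ≠ b := by
    rintro rfl
    exact T.asymm hde (hout d had hdb)
  have hbc := hout c hac hcb
  have hbd := hout d had hdb
  have hbe := hout e hae heb
  obtain ⟨σ, hX, hσ⟩ := h.exists_reversed_copy (S₀ := {a, b, c, d, e}) (X := {a, b, c})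
    (by
      intro v hv
      simp only [Finset.mem_insert, Finset.mem_singleton] at hv ⊢
      tauto)
    Finset.card_le_three (by
      have := Finset.card_le_five (a := a) (b := b) (c := c) (d := d) (e := e); omega)
  have key : ∀ x, x ∈ ({a, b, c} : Finset V) →
      x = σ e ∨ x = σ d ∨ x = σ c ∨ x = σ a ∨ x = σ b := by
    intro x hx
    obtain ⟨u, hu, rfl⟩ := hX x hx
    simp only [Finset.mem_insert, Finset.mem_singleton] at hu
    rcases hu with rfl | rfl | rfl | rfl | rfl <;> simp
  have m : ∀ u v, u ∈ ({a, b, c, d, e} : Finset V) → v ∈ ({a, b, c, d, e} : Finset V) →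
      T.Adj u v → T.Adj (σ v) (σ u) := fun u v hu hv => hσ u hu v hv
  exact T.asymm hac (dominates_of_twins (m d e (by simp) (by simp) hde)
    (m c d (by simp) (by simp) hcd) (m e c (by simp) (by simp) hec)
    (m a e (by simp) (by simp) hae) (m a d (by simp) (by simp) had) (m a c (by simp) (by simp) hac)
    (m b e (by simp) (by simp) hbe) (m b d (by simp) (by simp) hbd) (m b c (by simp) (by simp) hbc)
    htw (T.ne_of_adj hab) (T.ne_of_adj hac) hcb.symm (key a (by simp)) (key b (by simp))
    (key c (by simp)))

/-! ### Local transitivity -/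

/-- A tournament is locally transitive if both the out-neighbourhood and the in-neighbourhood of
every vertex are transitive. -/
def IsLocallyTransitive {V : Type*} (T : Tournament V) : Prop :=
  ∀ x, T.TransOn {y | T.Adj x y} ∧ T.TransOn {y | T.Adj y x}

theorem IsLocallyTransitive.dual {V : Type*} {T : Tournament V} (h : T.IsLocallyTransitive) :
    T.dual.IsLocallyTransitive :=
  fun x => ⟨(h x).2.dual, (h x).1.dual⟩

/-- Around a vertex `x` of a locally transitive tournament, the vertices of the out-neighbourhood that
dominate a given in-neighbour `n` form a final segment. -/
theorem IsLocallyTransitive.adj_of_out {V : Type*} {T : Tournament V} (h : T.IsLocallyTransitive)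
    {x o o' n : V} (ho : T.Adj x o) (hn : T.Adj n x) (hoo : T.Adj o o')
    (hon : T.Adj o n) (ho' : T.Adj x o') : T.Adj o' n := by
  have hne : o' ≠ n := by
    rintro rfl
    exact T.asymm hn ho'
  refine (T.total hne).resolve_right fun h1 => ?_
  exact T.asymm hn ((h o').2 x ho' o hoo n h1 ho hon)

/-- The in-neighbours of `x` dominated by a given out-neighbour form an initial segment of the
in-neighbourhood. -/
theorem IsLocallyTransitive.adj_of_in {V : Type*} {T : Tournament V} (h : T.IsLocallyTransitive)
    {x o n n' : V} (ho : T.Adj x o) (hn : T.Adj n x) (hnn : T.Adj n n')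
    (hon : T.Adj o n') (hn' : T.Adj n' x) : T.Adj o n :=
  h.dual.adj_of_out (x := x) hn' ho hnn hon hn

/-- Twins force local transitivity everywhere: around `a` the out- and in-neighbourhoods are
transitive and the arcs between them are monotone, which excludes every `3`-cycle with a source or a
sink. -/
theorem isLocallyTransitive_of_twins {V : Type*} [Fintype V] {T : Tournament V}
    (h : T.IsMinusSelfDual 3) (hn : 8 ≤ Fintype.card V) {a b : V} (hab : T.Adj a b)
    (htw : ∀ x, x ≠ a → x ≠ b → (T.Adj x a ↔ T.Adj x b)) : T.IsLocallyTransitive := by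
  have hO : T.TransOn {x | T.Adj a x} := twins_out_transOn h hn hab htw
  have hN : T.TransOn {x | T.Adj x a} := by
    have := twins_out_transOn (T := T.dual) (a := b) (b := a) h.dual hn hab fun x hxb hxa => by
      have h1 := htw x hxa hxb
      have h2 := T.adj_iff x a hxa
      have h3 := T.adj_iff x b hxb
      change T.Adj b x ↔ T.Adj a x
      tauto
    refine this.dual.mono fun x hx => ?_
    simp only [Set.mem_ofPred_eq] at hx ⊢
    refine (htw x (T.ne_of_adj hx) ?_).1 hx
    rintro rfl
    exact T.asymm hab hx
  have hO' : ∀ x y z, T.Adj a x → T.Adj a y → T.Adj a z → T.Adj x y → T.Adj y z → T.Adj x z :=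
    fun x y z hx hy hz => hO x hx y hy z hz
  have hN' : ∀ x y z, T.Adj x a → T.Adj y a → T.Adj z a → T.Adj x y → T.Adj y z → T.Adj x z :=
    fun x y z hx hy hz => hN x hx y hy z hz
  have as := fun x y => T.asymm (x := x) (y := y)
  have h1 : ∀ o o' n, T.Adj a o → T.Adj a o' → T.Adj n a → T.Adj o o' → T.Adj o n →
      ¬ T.Adj n o' := by
    intro o o' n ho ho' hn' hoo hon hno
    obtain ⟨e, h1, h2, h3⟩ := exists_fourth_of_sink h (by omega) ho hon hn' ho' hoo hno
      (a := a) (b := o) (c := o') (by simp) (by simp) (by simp) ho hoo ho'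
    exact T.asymm hoo (hO o' ho' e h1 o ho h2 h3)
  have h2 : ∀ o n n', T.Adj a o → T.Adj n a → T.Adj n' a → T.Adj n n' → T.Adj o n' →
      ¬ T.Adj n o := by
    intro o n n' ho hna hna' hnn hon hno
    obtain ⟨e, h1, h2, h3⟩ := exists_fourth_of_source h (by omega) ho hon hna' hna hno hnn
      (a := n) (b := n') (c := a) (by simp) (by simp) (by simp) hnn hna' hna
    exact T.asymm hnn (hN n' hna' e h1 n hna h3 h2)
  have tri : ∀ v, v = a ∨ T.Adj a v ∨ T.Adj v a := by
    intro v
    by_cases hv : v = a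
    · exact Or.inl hv
    · exact Or.inr (T.total (Ne.symm hv))
  have tot := fun x y => T.total (x := x) (y := y)
  clear h htw hO hN hn hab
  intro s
  refine ⟨transOn_of_no_cycle ?_, transOn_of_no_cycle ?_⟩ <;>
  · intro p hp q hq r hr hpq hqr hrp
    simp only [Set.mem_ofPred_eq] at hp hq hr
    rcases tri s with rfl | ts | ts <;> rcases tri p with rfl | tp | tp <;>
      rcases tri q with rfl | tq | tq <;> rcases tri r with rfl | tr | tr <;> grind

/-! ### Degrees and anti-automorphisms -/

open Classical in
/-- The set of vertices dominated by `x`. -/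
noncomputable def out {V : Type*} [Fintype V] (T : Tournament V) (x : V) : Finset V :=
  Finset.univ.filter fun y => T.Adj x y

open Classical in
/-- The set of vertices dominating `x`. -/
noncomputable def inn {V : Type*} [Fintype V] (T : Tournament V) (x : V) : Finset V :=
  Finset.univ.filter fun y => T.Adj y x

@[simp]
theorem mem_out {V : Type*} [Fintype V] {T : Tournament V} {x y : V} : y ∈ T.out x ↔ T.Adj x y := by
  simp [out]

@[simp]
theorem mem_inn {V : Type*} [Fintype V] {T : Tournament V} {x y : V} : y ∈ T.inn x ↔ T.Adj y x := by
  simp [inn]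

theorem card_out_inter_add_card_inn_inter {V : Type*} [Fintype V] [DecidableEq V]
    (T : Tournament V) (x : V) (W : Finset V) :
    (T.out x ∩ W).card + (T.inn x ∩ W).card = (W.erase x).card := by
  rw [← Finset.card_union_of_disjoint]
  · congr 1
    ext v
    simp only [Finset.mem_union, Finset.mem_inter, mem_out, mem_inn, Finset.mem_erase]
    constructor
    · rintro (⟨h, hW⟩ | ⟨h, hW⟩)
      · exact ⟨(T.ne_of_adj h).symm, hW⟩
      · exact ⟨T.ne_of_adj h, hW⟩
    · rintro ⟨h, hW⟩
      rcases T.total h with h | h <;> tauto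
  · rw [Finset.disjoint_left]
    intro v hv hv'
    simp only [Finset.mem_inter, mem_out, mem_inn] at hv hv'
    exact T.asymm hv.1 hv'.1

theorem card_out_add_card_inn {V : Type*} [Fintype V] (T : Tournament V) (x : V) :
    (T.out x).card + (T.inn x).card + 1 = Fintype.card V := by
  classical
  have := T.card_out_inter_add_card_inn_inter x Finset.univ
  rw [Finset.inter_univ, Finset.inter_univ, Finset.card_erase_of_mem (Finset.mem_univ x),
    Finset.card_univ] at this
  have := Fintype.card_pos_iff.2 ⟨x⟩
  omega

theorem ReversesOn.card_out_inter {V : Type*} [Fintype V] [DecidableEq V]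
    {T : Tournament V} {σ : Equiv.Perm V} {W : Finset V} (hrev : T.ReversesOn σ W) {n : V}
    (hn : n ∈ W) {B B' : Finset V} (hB : B ⊆ W)
    (hBB : ∀ v ∈ W, (σ v ∈ B' ↔ v ∈ B)) (hB' : ∀ v ∈ B', σ.symm v ∈ W) :
    (T.out n ∩ B).card = (T.inn (σ n) ∩ B').card := by
  refine Finset.card_bij (fun v _ => σ v) ?_ (fun _ _ _ _ he => σ.injective he) ?_
  · intro v hv
    simp only [Finset.mem_inter, mem_out, mem_inn] at hv ⊢
    exact ⟨hrev n hn v (hB hv.2) hv.1, (hBB v (hB hv.2)).2 hv.2⟩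
  · intro v hv
    simp only [Finset.mem_inter, mem_inn] at hv
    have hw := hB' v hv.2
    refine ⟨σ.symm v, ?_, by simp⟩
    simp only [Finset.mem_inter, mem_out]
    refine ⟨?_, (hBB _ hw).1 (by simpa using hv.2)⟩
    rw [← hrev.adj_iff hn hw]
    simpa using hv.1

/-- If `x` is the only vertex of maximum out-degree of a self dual `T[W]`, and `y` dominates in
`T[W]` exactly the vertices that dominate `x`, then an anti-automorphism of `T[W]` sends `x` to `y`
and preserves the in-neighbourhood `N` of `x`; hence there are as many arcs from `N` to the rest of
`W` as in the other direction. -/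
theorem IsMinusSelfDual.sum_out_eq_sum_inn {V : Type*} [Fintype V] [DecidableEq V]
    {T : Tournament V} {k : ℕ} (h : T.IsMinusSelfDual k) {W : Finset V}
    (hW : W.card + k = Fintype.card V) {x y : V} (hx : x ∈ W) (hy : y ∈ W)
    (hmax : ∀ v ∈ W, v ≠ x → (T.out v ∩ W).card < (T.out x ∩ W).card)
    (hxy : T.out y ∩ W = T.inn x ∩ W) :
    ∑ n ∈ T.inn x ∩ W, (T.out n ∩ (W \ T.inn x)).card
      = ∑ n ∈ T.inn x ∩ W, (T.inn n ∩ (W \ T.inn x)).card := by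
  obtain ⟨σ, hσ, hrev⟩ := h.exists_perm hW
  have hsymm : ∀ v ∈ W, σ.symm v ∈ W := fun v hv => by
    rw [← hσ]
    simpa using hv
  have hyx : σ x = y := by
    by_contra hne
    have h1 := hmax (σ.symm y) (hsymm y hy) fun he => hne (by rw [← he]; simp)
    rw [hrev.card_out_inter (hsymm y hy) subset_rfl (fun v _ => hσ v) hsymm] at h1
    simp only [Equiv.apply_symm_apply] at h1
    have h2 := T.card_out_inter_add_card_inn_inter y W
    have h3 := T.card_out_inter_add_card_inn_inter x W
    rw [Finset.card_erase_of_mem hx] at h3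
    rw [Finset.card_erase_of_mem hy, hxy] at h2
    omega
  have hN : ∀ v ∈ W, (T.Adj (σ v) x ↔ T.Adj v x) := by
    intro v hv
    rw [← hrev.adj_iff hv hx, hyx]
    have := Finset.ext_iff.1 hxy (σ v)
    simp only [Finset.mem_inter, mem_out, mem_inn, hσ v, hv, and_true] at this
    exact this.symm
  have hM : ∀ v ∈ W, (σ v ∈ W \ T.inn x ↔ v ∈ W \ T.inn x) := by
    intro v hv
    simp [hσ v, hN v hv]
  refine Finset.sum_bij (fun v _ => σ v) ?_ (fun _ _ _ _ he => σ.injective he) ?_ ?_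
  · intro v hv
    simp only [Finset.mem_inter, mem_inn] at hv ⊢
    exact ⟨(hN v hv.2).2 hv.1, (hσ v).2 hv.2⟩
  · intro v hv
    simp only [Finset.mem_inter, mem_inn] at hv
    refine ⟨σ.symm v, ?_, by simp⟩
    simp only [Finset.mem_inter, mem_inn]
    refine ⟨?_, hsymm v hv.2⟩
    rw [← hN _ (hsymm v hv.2)]
    simpa using hv.1
  · intro v hv
    exact hrev.card_out_inter (Finset.mem_inter.1 hv).2 Finset.sdiff_subset hM
      fun w hw => hsymm w (Finset.mem_sdiff.1 hw).1

/-! ### Excluding large cyclic triples of parts -/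

/-- Two parts of sizes at least two and total size exceeding `m ≥ 5` can be trimmed to distinct sizes,
still at least two, of total `m`. -/
theorem exists_distinct_parts {p q m : ℕ} (hp : 2 ≤ p) (hq : 2 ≤ q) (hm : 5 ≤ m) (hpq : m < p + q) :
    ∃ p' q', p' ≤ p ∧ q' ≤ q ∧ 2 ≤ p' ∧ 2 ≤ q' ∧ p' ≠ q' ∧ p' + q' = m := by
  by_cases h1 : 2 * max 2 (m - q) = m
  · exact ⟨max 2 (m - q) + 1, m - (max 2 (m - q) + 1), by omega, by omega, by omega, by omega,
      by omega, by omega⟩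
  · exact ⟨max 2 (m - q), m - max 2 (m - q), by omega, by omega, by omega, by omega,
      by omega, by omega⟩

/-- `T` has no almost spanning part of the shape `A → B → c → A` with transitive parts `A`, `B` of
size at least two. After trimming `A` and `B` to different sizes, `c` is the only vertex lying on
all `3`-cycles of the remaining tournament, so an anti-automorphism fixes `c` and exchanges `A` and
`B`, which is absurd. -/
theorem IsMinusSelfDual.no_three_part_cycle {V : Type*} [Fintype V] {T : Tournament V}
    (h : T.IsMinusSelfDual 3) (hn : 9 ≤ Fintype.card V) {A B : Finset V} {c : V}
    (hA : T.TransOn A) (hB : T.TransOn B) (hAB : ∀ a ∈ A, ∀ b ∈ B, T.Adj a b)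
    (hBc : ∀ b ∈ B, T.Adj b c) (hcA : ∀ a ∈ A, T.Adj c a) (hA2 : 2 ≤ A.card) (hB2 : 2 ≤ B.card)
    (hcard : Fintype.card V ≤ A.card + B.card + 3) : False := by
  classical
  obtain ⟨p, q, hp, hq, hp2, hq2, hpq, hsum⟩ := exists_distinct_parts hA2 hB2
    (m := Fintype.card V - 4) (by omega) (by omega)
  obtain ⟨A', hA', rfl⟩ := Finset.exists_subset_card_eq hp
  obtain ⟨B', hB', rfl⟩ := Finset.exists_subset_card_eq hq
  replace hA : T.TransOn A' := hA.mono (by exact_mod_cast hA')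
  replace hB : T.TransOn B' := hB.mono (by exact_mod_cast hB')
  replace hAB : ∀ a ∈ A', ∀ b ∈ B', T.Adj a b := fun a ha b hb => hAB a (hA' ha) b (hB' hb)
  replace hBc : ∀ b ∈ B', T.Adj b c := fun b hb => hBc b (hB' hb)
  replace hcA : ∀ a ∈ A', T.Adj c a := fun a ha => hcA a (hA' ha)
  have hcA' : c ∉ A' := fun hc => T.loopless _ (hcA c hc)
  have hcB' : c ∉ B' := fun hc => T.loopless _ (hBc c hc)
  have hdisj : Disjoint A' B' :=
    Finset.disjoint_left.2 fun v hv hv' => T.loopless _ (hAB v hv v hv')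
  have hWc : (insert c (A' ∪ B')).card + 3 = Fintype.card V := by
    rw [Finset.card_insert_of_notMem (by simp [hcA', hcB']), Finset.card_union_of_disjoint hdisj]
    omega
  obtain ⟨σ, hσ, hrev⟩ := h.exists_perm hWc
  have hcyc : ∀ u ∈ insert c (A' ∪ B'), ∀ v ∈ insert c (A' ∪ B'), ∀ w ∈ insert c (A' ∪ B'),
      T.Adj u v → T.Adj v w → T.Adj w u → c = u ∨ c = v ∨ c = w := by
    have as := fun x y => T.asymm (x := x) (y := y)
    have hA'' : ∀ x ∈ A', ∀ y ∈ A', ∀ z ∈ A', T.Adj x y → T.Adj y z → T.Adj x z := hA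
    have hB'' : ∀ x ∈ B', ∀ y ∈ B', ∀ z ∈ B', T.Adj x y → T.Adj y z → T.Adj x z := hB
    intro u hu v hv w hw huv hvw hwu
    simp only [Finset.mem_insert, Finset.mem_union] at hu hv hw
    clear hσ hrev hWc hA hB hA' hB' hn h
    rcases hu with rfl | hu | hu <;> rcases hv with rfl | hv | hv <;>
      rcases hw with rfl | hw | hw <;> grind
  have himg : ∀ a ∈ A', ∀ b ∈ B', c = σ b ∨ c = σ a ∨ c = σ c := by
    intro a ha b hb
    have hc : c ∈ insert c (A' ∪ B') := by simp
    have ha' : a ∈ insert c (A' ∪ B') := by simp [ha]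
    have hb' : b ∈ insert c (A' ∪ B') := by simp [hb]
    exact hcyc _ ((hσ b).2 hb') _ ((hσ a).2 ha') _ ((hσ c).2 hc) (hrev a ha' b hb' (hAB a ha b hb))
      (hrev c hc a ha' (hcA a ha)) (hrev b hb' c hc (hBc b hb))
  have hfix : σ c = c := by
    obtain ⟨a₁, ha₁, a₂, ha₂, hne⟩ := Finset.one_lt_card.1 hp2
    obtain ⟨b₁, hb₁, b₂, hb₂, hne'⟩ := Finset.one_lt_card.1 hq2
    have inj := fun u v => σ.injective (a₁ := u) (a₂ := v)
    have d := Finset.disjoint_left.1 hdisj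
    have h1 := himg a₁ ha₁ b₁ hb₁
    have h2 := himg a₂ ha₂ b₂ hb₂
    by_contra hcon
    rcases h1 with h1 | h1 | h1 <;> rcases h2 with h2 | h2 | h2 <;>
      first
      | exact hcon h1.symm
      | exact hcon h2.symm
      | (have h3 := inj _ _ (h1.symm.trans h2)
         subst h3
         first
         | exact hne rfl
         | exact hne' rfl
         | exact d ha₂ hb₁
         | exact d ha₁ hb₂)
  have hcW : c ∈ insert c (A' ∪ B') := by simp
  have h1 := hrev.card_out_inter hcW subset_rfl (fun v _ => hσ v) (fun v hv => by
    rw [← hσ]; simpa using hv)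
  rw [hfix] at h1
  have e1 : T.out c ∩ insert c (A' ∪ B') = A' := by
    ext v
    simp only [Finset.mem_inter, mem_out, Finset.mem_insert, Finset.mem_union]
    constructor
    · rintro ⟨h1, rfl | h2 | h2⟩
      · exact absurd h1 (T.loopless _)
      · exact h2
      · exact absurd h1 (T.asymm (hBc v h2))
    · exact fun hv => ⟨hcA v hv, Or.inr (Or.inl hv)⟩
  have e2 : T.inn c ∩ insert c (A' ∪ B') = B' := by
    ext v
    simp only [Finset.mem_inter, mem_inn, Finset.mem_insert, Finset.mem_union]
    constructor
    · rintro ⟨h1, rfl | h2 | h2⟩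
      · exact absurd h1 (T.loopless _)
      · exact absurd h1 (T.asymm (hcA v h2))
      · exact h2
    · exact fun hv => ⟨hBc v hv, Or.inr (Or.inr hv)⟩
  rw [e1, e2] at h1
  exact hpq h1

/-! ### Neighbourhoods of a vertex of maximum out-degree -/

theorem mem_or_of_notMem_inn {V : Type*} [Fintype V] {T : Tournament V} {x v : V}
    (hv : v ∉ T.inn x) : v = x ∨ T.Adj x v := by
  by_cases h : v = x
  · exact Or.inl h
  · exact Or.inr ((T.total h).resolve_left (by simpa using hv))

theorem card_compl_inn {V : Type*} [Fintype V] [DecidableEq V] (T : Tournament V) (x : V) :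
    ((T.inn x)ᶜ).card = (T.out x).card + 1 := by
  have := T.card_out_add_card_inn x
  rw [Finset.card_compl]
  omega

theorem IsLocallyTransitive.transOn_compl_inn {V : Type*} [Fintype V] {T : Tournament V}
    (hT : T.IsLocallyTransitive) (x : V) : T.TransOn {v | v ∉ T.inn x} := by
  intro a ha b hb c hc hab hbc
  have hO : ∀ a b c, T.Adj x a → T.Adj x b → T.Adj x c → T.Adj a b → T.Adj b c → T.Adj a c :=
    fun a b c h1 h2 h3 => (hT x).1 a h1 b h2 c h3
  have as := fun x y => T.asymm (x := x) (y := y)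
  rcases mem_or_of_notMem_inn ha with rfl | ha <;> rcases mem_or_of_notMem_inn hb with rfl | hb <;>
    rcases mem_or_of_notMem_inn hc with rfl | hc <;> grind

/-- For `n` dominating `x`, the vertices outside the in-neighbourhood of `x` that `n` dominates form
an initial segment. -/
theorem IsLocallyTransitive.adj_of_mem_sdiff {V : Type*} [Fintype V] [DecidableEq V]
    {T : Tournament V} (hT : T.IsLocallyTransitive) {x n a b : V} (hn : T.Adj n x)
    (ha : a ∈ T.out n \ T.inn x) (hb : b ∈ T.inn n \ T.inn x) : T.Adj a b := by
  simp only [Finset.mem_sdiff, mem_out] at ha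
  rw [Finset.mem_sdiff, mem_inn] at hb
  have hab : a ≠ b := by
    rintro rfl
    exact T.asymm ha.1 hb.1
  rcases mem_or_of_notMem_inn hb.2 with rfl | h2
  · exact absurd hn (T.asymm hb.1)
  rcases mem_or_of_notMem_inn (x := x) (v := a) (by simpa using ha.2) with rfl | h1
  · exact h2
  refine (T.total hab).resolve_right fun h3 => ?_
  exact T.asymm ha.1 (hT.adj_of_out h2 hn h3 hb.1 h1)

theorem card_out_sdiff_add {V : Type*} [Fintype V] [DecidableEq V] (T : Tournament V) {x n : V}
    (hn : T.Adj n x) :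
    (T.out n \ T.inn x).card + (T.inn n \ T.inn x).card = (T.out x).card + 1 := by
  have h := T.card_out_inter_add_card_inn_inter n (T.inn x)ᶜ
  rw [Finset.erase_eq_of_notMem (by simpa using hn), card_compl_inn] at h
  rw [Finset.sdiff_eq_inter_compl, Finset.sdiff_eq_inter_compl]
  convert h

theorem card_out_sdiff_le {V : Type*} [Fintype V] [DecidableEq V] {T : Tournament V} {x : V}
    (hmax : ∀ v, (T.out v).card ≤ (T.out x).card) (n : V) :
    (T.out n \ T.inn x).card ≤ (T.out x).card :=
  (Finset.card_le_card Finset.sdiff_subset).trans (hmax n)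

theorem self_mem_out_sdiff {V : Type*} [Fintype V] [DecidableEq V] {T : Tournament V} {x n : V}
    (hn : T.Adj n x) : x ∈ T.out n \ T.inn x := by
  simpa using ⟨hn, T.loopless x⟩

/-- If `x` has maximum out-degree, the last vertex dominated by `x` dominates exactly the vertices
that dominate `x`. -/
theorem IsLocallyTransitive.exists_antipode {V : Type*} [Fintype V] {T : Tournament V}
    (hT : T.IsLocallyTransitive) {x : V} (hmax : ∀ v, (T.out v).card ≤ (T.out x).card)
    (hne : (T.out x).Nonempty) :
    ∃ y, T.Adj x y ∧ (∀ o, T.Adj x o → o ≠ y → T.Adj o y) ∧ T.out y = T.inn x := by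
  classical
  obtain ⟨y, hy, hlast⟩ := TransOn.exists_last (T := T) (A := T.out x)
    ((hT x).1.mono fun v hv => by simpa using hv) hne
  simp only [mem_out] at hy hlast
  refine ⟨y, hy, hlast, ?_⟩
  ext v
  simp only [mem_out, mem_inn]
  constructor
  · intro hyv
    have hvx : v ≠ x := by
      rintro rfl
      exact T.asymm hy hyv
    refine (T.total hvx).resolve_right fun h1 => ?_
    exact T.asymm hyv (hlast v h1 (T.ne_of_adj hyv).symm)
  · intro hvx
    have hyv : y ≠ v := by
      rintro rfl
      exact T.asymm hy hvx
    refine (T.total hyv).resolve_right fun h1 => ?_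
    have hsub : insert x (T.out x) ⊆ T.out v := by
      intro o ho
      simp only [Finset.mem_insert, mem_out] at ho ⊢
      rcases ho with rfl | ho
      · exact hvx
      · by_cases hoy : o = y
        · rwa [hoy]
        · have hov : o ≠ v := by
            rintro rfl
            exact T.asymm ho hvx
          refine (T.total hov).resolve_left fun h2 => ?_
          exact T.asymm h1 (hT.adj_of_out ho hvx (hlast o ho hoy) h2 hy)
    have h1 := Finset.card_le_card hsub
    rw [Finset.card_insert_of_notMem (by simpa using T.loopless x)] at h1
    have := hmax v
    omega

/-- If `x` has in-degree at most three, an in-neighbour `n` splits the non-in-neighbours of `x` into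
`A → B → n → A`, and one of these two parts is a singleton. -/
theorem card_sdiff_eq_one_or {V : Type*} [Fintype V] [DecidableEq V] {T : Tournament V}
    (h : T.IsMinusSelfDual 3) (hn : 9 ≤ Fintype.card V) (hT : T.IsLocallyTransitive) {x n : V}
    (hmax : ∀ v, (T.out v).card ≤ (T.out x).card) (hl : (T.inn x).card ≤ 3) (hnx : T.Adj n x) :
    (T.out n \ T.inn x).card = 1 ∨ (T.inn n \ T.inn x).card = 1 := by
  by_contra hcon
  rw [not_or] at hcon
  have h1 := T.card_out_sdiff_add hnx
  have h2 := card_out_sdiff_le hmax n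
  have h3 := Finset.card_pos.2 ⟨x, self_mem_out_sdiff hnx⟩
  have h4 := T.card_out_add_card_inn x
  have htr := hT.transOn_compl_inn x
  exact h.no_three_part_cycle hn (A := T.out n \ T.inn x) (B := T.inn n \ T.inn x) (c := n)
    (htr.mono fun v hv => by
      rw [Finset.mem_coe, Finset.mem_sdiff] at hv
      exact hv.2)
    (htr.mono fun v hv => by
      rw [Finset.mem_coe, Finset.mem_sdiff] at hv
      exact hv.2)
    (fun a ha b hb => hT.adj_of_mem_sdiff hnx ha hb)
    (fun b hb => by
      rw [Finset.mem_sdiff, mem_inn] at hb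
      exact hb.1)
    (fun a ha => by
      rw [Finset.mem_sdiff, mem_out] at ha
      exact ha.1)
    (by omega) (by omega) (by omega)

/-! ### Maximum out-degree with in-degree at most three -/

/-- The recognition criterion for almost transitive tournaments: reversing the arc `(b, a)` makes
`a` the first and `b` the last vertex of a transitive tournament. -/
theorem isAlmostTransitive_of_adj {V : Type*} [Fintype V] {T : Tournament V}
    (hn : 3 ≤ Fintype.card V) {a b : V} (hba : T.Adj b a)
    (hab : ∀ v, v ≠ a → v ≠ b → T.Adj a v ∧ T.Adj v b)
    (htr : T.TransOn {v | v ≠ a ∧ v ≠ b}) : T.IsAlmostTransitive := by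
  have hne := T.ne_of_adj hba
  have as := fun x y => T.asymm (x := x) (y := y)
  have ir := T.loopless
  have htr' : ∀ u v w, u ≠ a → u ≠ b → v ≠ a → v ≠ b → w ≠ a → w ≠ b → T.Adj u v → T.Adj v w →
      T.Adj u w := fun u v w h1 h2 h3 h4 h5 h6 => htr u ⟨h1, h2⟩ v ⟨h3, h4⟩ w ⟨h5, h6⟩
  have hadj : ∀ u v, (T.reverseArc a b).Adj u v ↔
      ((u = a ∧ v = b) ∨ (u = b ∧ v = a)) ∧ T.Adj v u ∨
      ¬ ((u = a ∧ v = b) ∨ (u = b ∧ v = a)) ∧ T.Adj u v := by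
    intro u v
    simp only [reverseArc]
    split_ifs with h <;> tauto
  refine ⟨hn, T.reverseArc a b, ?_, a, b, ?_, ?_, ?_⟩
  · intro u v w huv hvw
    rw [hadj] at *
    clear hadj htr hn
    by_cases hu : u = a <;> by_cases hu' : u = b <;> by_cases hv : v = a <;> by_cases hv' : v = b <;>
      by_cases hw : w = a <;> by_cases hw' : w = b <;> grind
  · intro v hv
    rw [hadj]
    by_cases hvb : v = b
    · subst hvb
      exact Or.inl ⟨Or.inl ⟨rfl, rfl⟩, hba⟩
    · exact Or.inr ⟨by tauto, (hab v hv hvb).1⟩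
  · intro v hv
    rw [hadj]
    by_cases hvb : v = a
    · subst hvb
      exact Or.inl ⟨Or.inl ⟨rfl, rfl⟩, hba⟩
    · exact Or.inr ⟨by tauto, (hab v hvb hv).2⟩
  · cases T with
    | mk D h1 h2 =>
      simp only [reverseArc, Tournament.mk.injEq]
      ext u v
      simp only
      split_ifs with h3 h4 <;> tauto

/-- Small in-degree. Each in-neighbour of `x` dominates either only `x` or everything except the
antipode `y` outside the in-neighbourhood. With a single in-neighbour both options give an almost
transitive tournament. Two or three in-neighbours are excluded by maximality of the degree of `x`,
except for one in-neighbour of each kind, where a large cyclic triple of parts appears. -/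
theorem transitive_or_almostTransitive_of_card_inn_le {V : Type*} [Fintype V] {T : Tournament V}
    (h : T.IsMinusSelfDual 3) (hn : 9 ≤ Fintype.card V) (hT : T.IsLocallyTransitive) {x : V}
    (hmax : ∀ v, (T.out v).card ≤ (T.out x).card) (hl : (T.inn x).card ≤ 3) :
    T.IsTransitive ∨ T.IsAlmostTransitive := by
  classical
  have hk := T.card_out_add_card_inn x
  have htr := hT.transOn_compl_inn x
  have hone := fun v (hv : T.Adj v x) => card_sdiff_eq_one_or h hn hT hmax hl hv
  -- The vertices dominating `x` split by the position of the segment they dominate.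
  have hA : ∀ v, T.Adj v x → (T.out v \ T.inn x).card = 1 → ∀ o, T.Adj x o → T.Adj o v := by
    intro v hv h1 o ho
    obtain ⟨w, hw⟩ := Finset.card_eq_one.1 h1
    have hx := self_mem_out_sdiff hv
    rw [hw, Finset.mem_singleton] at hx
    subst hx
    have hov : o ≠ v := by
      rintro rfl
      exact T.asymm ho hv
    refine (T.total hov).resolve_right fun h2 => ?_
    have : o ∈ T.out v \ T.inn x := by simpa using ⟨h2, T.asymm ho⟩
    rw [hw, Finset.mem_singleton] at this
    exact T.ne_of_adj ho this.symm
  obtain ⟨y, hxy, hlast, hyN⟩ := hT.exists_antipode hmax (Finset.card_pos.1 (by omega))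
  have hyN' : ∀ v, T.Adj v x → T.Adj y v := fun v hv => by
    rw [← mem_out, hyN, mem_inn]
    exact hv
  have hB : ∀ v, T.Adj v x → (T.inn v \ T.inn x).card = 1 → ∀ o, T.Adj x o → o ≠ y →
      T.Adj v o := by
    intro v hv h1 o ho hoy
    obtain ⟨w, hw⟩ := Finset.card_eq_one.1 h1
    have hy : y ∈ T.inn v \ T.inn x := by simpa using ⟨hyN' v hv, T.asymm hxy⟩
    rw [hw, Finset.mem_singleton] at hy
    subst hy
    have hov : o ≠ v := by
      rintro rfl
      exact T.asymm ho hv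
    refine (T.total hov).resolve_left fun h2 => ?_
    have : o ∈ T.inn v \ T.inn x := by simpa using ⟨h2, T.asymm ho⟩
    rw [hw, Finset.mem_singleton] at this
    exact hoy this
  rcases Nat.lt_or_ge (T.inn x).card 2 with hl2 | hl2
  · rcases Nat.lt_or_ge (T.inn x).card 1 with hl1 | hl1
    · left
      have h0 : T.inn x = ∅ := Finset.card_eq_zero.1 (by omega)
      intro u v w huv hvw
      exact htr u (by simp [h0]) v (by simp [h0]) w (by simp [h0]) huv hvw
    · right
      obtain ⟨c, hc⟩ := Finset.card_eq_one.1 (show (T.inn x).card = 1 by omega)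
      have hcx : T.Adj c x := by
        rw [← mem_inn, hc]
        simp
      have hout : ∀ v, v ≠ c → v ≠ x → T.Adj x v := by
        intro v hvc hvx
        refine (T.total hvx).resolve_left fun h1 => hvc ?_
        rw [← mem_inn, hc] at h1
        simpa using h1
      rcases hone c hcx with h1 | h1
      · refine isAlmostTransitive_of_adj (by omega) hcx
          (fun v hvx hvc => ⟨hout v hvc hvx, hA c hcx h1 v (hout v hvc hvx)⟩)
          (htr.mono fun v hv => ?_)
        simpa using T.asymm (hout v hv.2 hv.1)
      · refine isAlmostTransitive_of_adj (by omega) (hyN' c hcx) (fun v hvc hvy => ?_)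
          (htr.mono fun v hv => ?_)
        · by_cases hvx : v = x
          · subst hvx
            exact ⟨hcx, hxy⟩
          · exact ⟨hB c hcx h1 v (hout v hvc hvx) hvy, hlast v (hout v hvc hvx) hvy⟩
        · simp only [Set.mem_ofPred_eq, hc, Finset.mem_singleton]
          exact hv.1
  · exfalso
    set N₁ := (T.inn x).filter fun v => (T.out v \ T.inn x).card = 1 with hN₁
    set N₂ := (T.inn x).filter fun v => (T.inn v \ T.inn x).card = 1 with hN₂
    have hN : T.inn x ⊆ N₁ ∪ N₂ := by
      intro v hv
      have := hone v (by simpa using hv)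
      simp only [hN₁, hN₂, Finset.mem_union, Finset.mem_filter]
      tauto
    -- The first out-neighbour of `x` dominates all of `N₁`; the first vertex of `N₂` dominates the
    -- rest of `N₂`. Neither may exceed the out-degree of `x`.
    have hN₁c : N₁.card ≤ 1 := by
      obtain ⟨o, ho, hfirst⟩ := TransOn.exists_first (T := T) (A := T.out x)
        ((hT x).1.mono fun v hv => by simpa using hv) ⟨y, by simpa using hxy⟩
      simp only [mem_out] at ho hfirst
      have hsub : (T.out x).erase o ∪ N₁ ⊆ T.out o := by
        intro v hv
        simp only [Finset.mem_union, Finset.mem_erase, mem_out, hN₁, Finset.mem_filter,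
          mem_inn] at hv ⊢
        rcases hv with hv | hv
        · exact hfirst v hv.2 hv.1
        · exact hA v hv.1 hv.2 o ho
      have h1 := Finset.card_le_card hsub
      rw [Finset.card_union_of_disjoint, Finset.card_erase_of_mem (by simpa using ho)] at h1
      · have := hmax o
        omega
      · rw [Finset.disjoint_left]
        intro v hv hv'
        simp only [Finset.mem_erase, mem_out, hN₁, Finset.mem_filter, mem_inn] at hv hv'
        exact T.asymm hv.2 hv'.1
    have hN₂c : N₂.card ≤ 1 := by
      rcases N₂.eq_empty_or_nonempty with he | hne
      · simp [he]
      obtain ⟨v, hv, hfirst⟩ := TransOn.exists_first (T := T) (A := N₂)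
        ((hT x).2.mono fun v hv => by
          have := (Finset.mem_filter.1 hv).1
          simpa using this) hne
      have hsub : N₂.erase v ∪ (T.out v \ T.inn x) ⊆ T.out v := by
        intro w hw
        rcases Finset.mem_union.1 hw with hw | hw
        · rw [mem_out]
          exact hfirst w (Finset.mem_of_mem_erase hw) (Finset.ne_of_mem_erase hw)
        · exact Finset.sdiff_subset hw
      have h1 := Finset.card_le_card hsub
      have hvm := Finset.mem_filter.1 hv
      rw [Finset.card_union_of_disjoint, Finset.card_erase_of_mem hv] at h1
      · have h2 := hmax v
        have h3 := T.card_out_sdiff_add (x := x) (n := v) (by simpa using hvm.1)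
        omega
      · rw [Finset.disjoint_left]
        intro w hw hw'
        exact (Finset.mem_sdiff.1 hw').2 (Finset.mem_filter.1 (Finset.mem_of_mem_erase hw)).1
    have hle := (Finset.card_le_card hN).trans (Finset.card_union_le _ _)
    obtain ⟨n₁, hn₁⟩ := Finset.card_eq_one.1 (show N₁.card = 1 by omega)
    obtain ⟨n₂, hn₂⟩ := Finset.card_eq_one.1 (show N₂.card = 1 by omega)
    have h₁ : n₁ ∈ N₁ := by simp [hn₁]
    have h₂ : n₂ ∈ N₂ := by simp [hn₂]
    simp only [hN₁, hN₂, Finset.mem_filter, mem_inn] at h₁ h₂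
    have hs₁ := T.card_out_sdiff_add h₁.1
    have hs₂ := T.card_out_sdiff_add h₂.1
    have hne : n₁ ≠ n₂ := by
      rintro rfl
      omega
    have h12 : T.Adj n₁ n₂ := by
      refine (T.total hne).resolve_right fun h3 => ?_
      have hsub : insert n₁ (T.out n₂ \ T.inn x) ⊆ T.out n₂ :=
        Finset.insert_subset (by simpa using h3) Finset.sdiff_subset
      have h4 := Finset.card_le_card hsub
      rw [Finset.card_insert_of_notMem (by simp [h₁.1])] at h4
      have := hmax n₂
      omega
    have hyn₁ := hA n₁ h₁.1 h₁.2 y hxy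
    refine h.no_three_part_cycle hn (A := (T.out x).erase y) (B := {y, n₁}) (c := n₂)
      ((hT x).1.mono fun v hv => by simpa using Finset.mem_of_mem_erase hv) ?_ ?_ ?_ ?_ ?_ ?_ ?_
    · intro a ha b hb c hc hab hbc
      have as := fun x y => T.asymm (x := x) (y := y)
      simp only [Finset.coe_insert, Finset.coe_singleton, Set.mem_insert_iff,
        Set.mem_singleton_iff] at ha hb hc
      rcases ha with rfl | rfl <;> rcases hb with rfl | rfl <;> rcases hc with rfl | rfl <;> grind
    · intro a ha b hb
      simp only [Finset.mem_erase, mem_out, Finset.mem_insert, Finset.mem_singleton] at ha hb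
      rcases hb with rfl | rfl
      · exact hlast a ha.2 ha.1
      · exact hA _ h₁.1 h₁.2 a ha.2
    · intro b hb
      simp only [Finset.mem_insert, Finset.mem_singleton] at hb
      rcases hb with rfl | rfl
      · exact hyN' _ h₂.1
      · exact h12
    · intro a ha
      simp only [Finset.mem_erase, mem_out] at ha
      exact hB n₂ h₂.1 h₂.2 a ha.2 ha.1
    · rw [Finset.card_erase_of_mem (by simpa using hxy)]
      omega
    · rw [Finset.card_pair (T.ne_of_adj hyn₁)]
    · rw [Finset.card_erase_of_mem (by simpa using hxy), Finset.card_pair (T.ne_of_adj hyn₁)]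
      omega

/-! ### Maximum out-degree with in-degree at least four -/

theorem exists_adj_inn_of_card_out_eq {V : Type*} [Fintype V] {T : Tournament V} {x v : V}
    (hxv : T.Adj x v) (hv : (T.out v).card = (T.out x).card) : ∃ n, T.Adj n x ∧ T.Adj v n := by
  classical
  by_contra hcon
  push Not at hcon
  have hsub : T.out v ⊆ (T.out x).erase v := by
    intro w hw
    rw [mem_out] at hw
    simp only [Finset.mem_erase, mem_out]
    refine ⟨(T.ne_of_adj hw).symm, ?_⟩
    have hwx : w ≠ x := by
      rintro rfl
      exact T.asymm hxv hw
    exact (T.total hwx).resolve_left fun h => hcon w h hw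
  have h1 := Finset.card_le_card hsub
  rw [Finset.card_erase_of_mem (by simpa using hxv)] at h1
  have := Finset.card_pos.2 ⟨v, (mem_out (T := T)).2 hxv⟩
  omega

/-- Deleting a set `X` of `k` vertices that dominate `x` keeps the out-degree of `x`. If every other
vertex of maximum out-degree is deleted or loses an out-neighbour, then the arcs between the
remaining in-neighbours of `x` and the other vertices are balanced. -/
theorem IsMinusSelfDual.sum_sdiff_eq_zero {V : Type*} [Fintype V] [DecidableEq V]
    {T : Tournament V} {k : ℕ}
    (h : T.IsMinusSelfDual k) (hT : T.IsLocallyTransitive) {x : V}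
    (hmax : ∀ v, (T.out v).card ≤ (T.out x).card) (hne : (T.out x).Nonempty)
    {X : Finset V} (hX : ∀ v ∈ X, T.Adj v x) (hXk : X.card = k)
    (htie : ∀ v, v ≠ x → (T.out v).card = (T.out x).card → v ∈ X ∨ ∃ u ∈ X, T.Adj v u) :
    ∑ n ∈ T.inn x \ X, (((T.out n \ T.inn x).card : ℤ) - (T.inn n \ T.inn x).card) = 0 := by
  obtain ⟨y, hxy, hlast, hyN⟩ := hT.exists_antipode hmax hne
  have hW : (Xᶜ).card + k = Fintype.card V := by
    have := Finset.card_le_univ X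
    rw [Finset.card_compl]
    omega
  have hxX : x ∈ Xᶜ := by
    rw [Finset.mem_compl]
    exact fun hx => T.loopless _ (hX x hx)
  have hyX : y ∈ Xᶜ := by
    rw [Finset.mem_compl]
    exact fun hy => T.asymm hxy (hX y hy)
  have hxout : T.out x ∩ Xᶜ = T.out x := by
    rw [Finset.inter_eq_left]
    intro v hv
    rw [Finset.mem_compl]
    exact fun hv' => T.asymm (hX v hv') (by simpa using hv)
  have key := h.sum_out_eq_sum_inn hW hxX hyX (fun v hv hvx => by
    rw [hxout]
    refine lt_of_le_of_ne ((Finset.card_le_card Finset.inter_subset_left).trans (hmax v)) ?_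
    intro he
    have h1 : (T.out v).card = (T.out x).card :=
      le_antisymm (hmax v) (he ▸ Finset.card_le_card Finset.inter_subset_left)
    rcases htie v hvx h1 with h2 | ⟨u, hu, hvu⟩
    · exact (Finset.mem_compl.1 hv) h2
    · have h3 := Finset.eq_of_subset_of_card_le (Finset.inter_subset_left (s₁ := T.out v) (s₂ := Xᶜ))
        (by omega)
      have h4 : u ∈ T.out v ∩ Xᶜ := by
        rw [h3]
        simpa using hvu
      exact (Finset.mem_compl.1 (Finset.mem_inter.1 h4).2) hu) (by rw [hyN])
  have e1 : T.inn x ∩ Xᶜ = T.inn x \ X := (Finset.sdiff_eq_inter_compl _ _).symm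
  have e2 : ∀ S : Finset V, S ∩ (Xᶜ \ T.inn x) = S \ T.inn x := by
    intro S
    ext v
    simp only [Finset.mem_inter, Finset.mem_sdiff, Finset.mem_compl, mem_inn]
    exact ⟨fun hv => ⟨hv.1, hv.2.2⟩, fun hv => ⟨hv.1, fun h' => hv.2 (hX v h'), hv.2⟩⟩
  simp only [e1, e2] at key
  rw [Finset.sum_sub_distrib, sub_eq_zero]
  exact_mod_cast key

theorem IsLocallyTransitive.exists_first_last {V : Type*} [Fintype V] {T : Tournament V}
    (hT : T.IsLocallyTransitive) {x : V} (hl : 2 ≤ (T.inn x).card) :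
    ∃ a b, T.Adj a x ∧ T.Adj b x ∧ (∀ n, T.Adj n x → n ≠ a → T.Adj a n) ∧
      (∀ n, T.Adj n x → n ≠ b → T.Adj n b) ∧ a ≠ b := by
  have htr : T.TransOn (T.inn x) := (hT x).2.mono fun v hv => by simpa using hv
  have hne : (T.inn x).Nonempty := Finset.card_pos.1 (by omega)
  obtain ⟨a, ha, hfa⟩ := htr.exists_first hne
  obtain ⟨b, hb, hfb⟩ := htr.exists_last hne
  simp only [mem_inn] at ha hb hfa hfb
  refine ⟨a, b, ha, hb, hfa, hfb, ?_⟩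
  rintro rfl
  obtain ⟨c, hc, hca⟩ := Finset.exists_mem_ne (s := T.inn x) (by omega) a
  rw [mem_inn] at hc
  exact T.asymm (hfa c hc hca) (hfb c hc hca)

/-- A vertex dominated by `x` with the same out-degree dominates the first in-neighbour of `x`. -/
theorem IsLocallyTransitive.adj_first {V : Type*} [Fintype V] {T : Tournament V}
    (hT : T.IsLocallyTransitive) {x a v : V} (ha : T.Adj a x)
    (hfa : ∀ n, T.Adj n x → n ≠ a → T.Adj a n) (hxv : T.Adj x v)
    (hv : (T.out v).card = (T.out x).card) : T.Adj v a := by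
  obtain ⟨n, hn, hvn⟩ := exists_adj_inn_of_card_out_eq hxv hv
  by_cases hna : n = a
  · rwa [← hna]
  · exact hT.adj_of_in hxv ha (hfa n hn hna) hvn hn

/-- If `x` has maximum out-degree and in-degree at least four, every in-neighbour of `x` that is
neither the first nor the last one cuts the complement of the in-neighbourhood in two halves. -/
theorem IsMinusSelfDual.card_eq_of_between {V : Type*} [Fintype V] [DecidableEq V]
    {T : Tournament V}
    (h : T.IsMinusSelfDual 3) (hT : T.IsLocallyTransitive) {x : V}
    (hmax : ∀ v, (T.out v).card ≤ (T.out x).card) (hne : (T.out x).Nonempty)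
    (hl : 4 ≤ (T.inn x).card) {p u q : V} (hp : T.Adj p x) (hu : T.Adj u x) (hq : T.Adj q x)
    (hpu : T.Adj p u) (huq : T.Adj u q) :
    (T.out u \ T.inn x).card = (T.inn u \ T.inn x).card := by
  obtain ⟨a, b, ha, hb, hfa, hfb, hab⟩ := hT.exists_first_last (x := x) (by omega)
  set d : V → ℤ := fun n => ((T.out n \ T.inn x).card : ℤ) - (T.inn n \ T.inn x).card with hd
  set N := ((T.inn x).erase a).erase b with hN
  have hbN : b ∈ (T.inn x).erase a := by simp [hb, hab.symm]
  have hNc : N.card + 2 = (T.inn x).card := by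
    rw [hN, Finset.card_erase_of_mem hbN, Finset.card_erase_of_mem (by simpa using ha)]
    omega
  -- Deleting `a`, `b` and `w` shows that `d w` equals the total over all of `N`.
  have hsum : ∀ w ∈ N, d w = ∑ n ∈ N, d n := by
    intro w hw
    have hw' := hw
    simp only [hN, Finset.mem_erase, mem_inn] at hw'
    have h1 := h.sum_sdiff_eq_zero hT hmax hne (X := {a, b, w})
      (by
        simp only [Finset.mem_insert, Finset.mem_singleton]
        rintro v (rfl | rfl | rfl)
        exacts [ha, hb, hw'.2.2])
      (Finset.card_eq_three.2 ⟨a, b, w, hab, hw'.2.1.symm, hw'.1.symm, rfl⟩)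
      (fun v hvx hv => by
        rcases T.total hvx with h2 | h2
        · by_cases hvb : v = b
          · simp [hvb]
          · exact Or.inr ⟨b, by simp, hfb v h2 hvb⟩
        · exact Or.inr ⟨a, by simp, hT.adj_first ha hfa h2 hv⟩)
    have h2 : T.inn x \ {a, b, w} = N.erase w := by
      ext v
      simp only [hN, Finset.mem_sdiff, Finset.mem_insert, Finset.mem_singleton, Finset.mem_erase]
      tauto
    rw [h2] at h1
    rw [← Finset.add_sum_erase N d hw, h1, add_zero]
  have hD : ∑ n ∈ N, d n = 0 := by
    have h1 := Finset.sum_congr rfl hsum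
    rw [Finset.sum_const, nsmul_eq_mul] at h1
    have h2 : ((N.card : ℤ) - 1) * ∑ n ∈ N, d n = 0 := by linarith
    rcases mul_eq_zero.1 h2 with h3 | h3
    · omega
    · exact h3
  have huN : u ∈ N := by
    simp only [hN, Finset.mem_erase, mem_inn]
    refine ⟨?_, ?_, hu⟩
    · rintro rfl
      exact T.asymm huq (hfb q hq (T.ne_of_adj huq).symm)
    · rintro rfl
      exact T.asymm hpu (hfa p hp (T.ne_of_adj hpu))
  have := hsum u huN
  rw [hD] at this
  simp only [hd] at this
  omega

/-- The conclusion of the degree analysis is impossible: if all in-neighbours of a vertex `x` of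
maximum out-degree halve the remaining vertices, then `T` has the shape `A → B → N → A` with
`|A| = |B| ≥ |N| ≥ 4`, and deleting one vertex of `A` and two of `N` destroys the balance. -/
theorem IsMinusSelfDual.false_of_halving {V : Type*} [Fintype V] [DecidableEq V]
    {T : Tournament V} (h : T.IsMinusSelfDual 3) (hT : T.IsLocallyTransitive) {x : V}
    (hmax : ∀ v, (T.out v).card ≤ (T.out x).card) (hne : (T.out x).Nonempty)
    (hl : 4 ≤ (T.inn x).card)
    (hd : ∀ n, T.Adj n x → (T.out n \ T.inn x).card = (T.inn n \ T.inn x).card) : False := by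
  obtain ⟨a, b, ha, hb, hfa, -, hab⟩ := hT.exists_first_last (x := x) (by omega)
  obtain ⟨y, hxy, -, hyN⟩ := hT.exists_antipode hmax hne
  set A := T.out a \ T.inn x with hA
  set B := T.inn a \ T.inn x with hB
  have hg := fun n (hn : T.Adj n x) => T.card_out_sdiff_add hn
  have hAn : ∀ n, T.Adj n x → T.out n \ T.inn x = A := by
    intro n hn
    by_cases hna : n = a
    · rw [hna]
    refine (Finset.eq_of_subset_of_card_le ?_ ?_).symm
    · intro o ho
      simp only [hA, Finset.mem_sdiff, mem_out] at ho ⊢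
      refine ⟨?_, ho.2⟩
      rcases mem_or_of_notMem_inn ho.2 with rfl | hxo
      · exact hn
      · have hno : n ≠ o := by
          rintro rfl
          exact T.asymm hn hxo
        refine (T.total hno).resolve_right fun h1 => ?_
        exact T.asymm ho.1 (hT.adj_of_in hxo ha (hfa n hn hna) h1 hn)
    · have h1 := hd n hn
      have h2 := hd a ha
      have h3 := hg n hn
      have h4 := hg a ha
      rw [hA]
      omega
  have hBn : ∀ n, T.Adj n x → T.inn n \ T.inn x = B := by
    intro n hn
    ext v
    have h1 := Finset.ext_iff.1 (hAn n hn) v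
    simp only [hA, hB, Finset.mem_sdiff, mem_out, mem_inn] at h1 ⊢
    have key : ∀ m, T.Adj m x → ¬ T.Adj v x → (T.Adj v m ↔ ¬ T.Adj m v) := by
      intro m hm hv
      refine T.adj_iff v m ?_
      rintro rfl
      exact hv hm
    by_cases hv : T.Adj v x
    · tauto
    · have := key n hn hv
      have := key a ha hv
      tauto
  have hAB : A.card = B.card := hd a ha
  have hk : A.card + B.card = (T.out x).card + 1 := hg a ha
  have hgl : (T.inn x).card ≤ A.card := by
    have hsub : (T.inn x).erase a ∪ A ⊆ T.out a := by
      refine Finset.union_subset (fun v hv => ?_) Finset.sdiff_subset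
      simp only [Finset.mem_erase, mem_inn, mem_out] at hv ⊢
      exact hfa v hv.2 hv.1
    have h1 := Finset.card_le_card hsub
    rw [Finset.card_union_of_disjoint, Finset.card_erase_of_mem (by simpa using ha)] at h1
    · have := hmax a
      omega
    · rw [Finset.disjoint_left]
      intro v hv hv'
      exact (Finset.mem_sdiff.1 hv').2 (Finset.mem_of_mem_erase hv)
  have hxA : x ∈ A := self_mem_out_sdiff ha
  obtain ⟨o, hoA, hox⟩ := Finset.exists_mem_ne (s := A) (by omega) x
  have hmemA : ∀ v, v ∈ A ↔ ¬ T.Adj v x ∧ ∀ n, T.Adj n x → T.Adj n v := by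
    intro v
    constructor
    · intro hv
      refine ⟨by simpa using (Finset.mem_sdiff.1 hv).2, fun n hn => ?_⟩
      rw [← hAn n hn, Finset.mem_sdiff, mem_out] at hv
      exact hv.1
    · rintro ⟨h1, h2⟩
      simpa [hA] using ⟨h2 a ha, h1⟩
  have hmemB : ∀ v, ¬ T.Adj v x → v ∉ A → v ∈ B := by
    intro v hv hvA
    simp only [hA, hB, Finset.mem_sdiff, mem_out, mem_inn] at hvA ⊢
    have hva : v ≠ a := by
      rintro rfl
      exact hv ha
    rcases T.total hva with h1 | h1 <;> tauto
  have hoO : T.Adj x o :=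
    ((mem_or_of_notMem_inn (Finset.mem_sdiff.1 hoA).2).resolve_left hox)
  have hoa : o ≠ a := by
    rintro rfl
    exact T.asymm ha hoO
  have hob : o ≠ b := by
    rintro rfl
    exact T.asymm hb hoO
  have hXc : ({o, a, b} : Finset V).card = 3 := Finset.card_eq_three.2 ⟨o, a, b, hoa, hob, hab, rfl⟩
  have hW : (({o, a, b} : Finset V)ᶜ).card + 3 = Fintype.card V := by
    have := Finset.card_le_univ ({o, a, b} : Finset V)
    rw [Finset.card_compl]
    omega
  have hmemW : ∀ v, v ∈ (({o, a, b} : Finset V)ᶜ) ↔ v ≠ o ∧ v ≠ a ∧ v ≠ b := by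
    intro v
    simp only [Finset.mem_compl, Finset.mem_insert, Finset.mem_singleton]
    tauto
  set W := (({o, a, b} : Finset V)ᶜ) with hWdef
  have hxW : x ∈ W := (hmemW x).2 ⟨hox.symm, (T.ne_of_adj ha).symm, (T.ne_of_adj hb).symm⟩
  have hyo : y ≠ o := by
    rintro rfl
    have h1 : T.Adj y a := by
      rw [← mem_out, hyN, mem_inn]
      exact ha
    exact T.asymm h1 (((hmemA y).1 hoA).2 a ha)
  have hyW : y ∈ W := by
    refine (hmemW y).2 ⟨hyo, ?_, ?_⟩
    · rintro rfl
      exact T.asymm ha hxy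
    · rintro rfl
      exact T.asymm hb hxy
  have hxout : T.out x ∩ W = (T.out x).erase o := by
    ext v
    simp only [Finset.mem_inter, mem_out, hmemW, Finset.mem_erase]
    constructor
    · tauto
    · rintro ⟨h1, h2⟩
      refine ⟨h2, h1, ?_, ?_⟩
      · rintro rfl
        exact T.asymm ha h2
      · rintro rfl
        exact T.asymm hb h2
  have hxoutc : (T.out x ∩ W).card + 1 = (T.out x).card := by
    rw [hxout, Finset.card_erase_add_one (by simpa using hoO)]
  have hNW : T.inn x ∩ W = ((T.inn x).erase a).erase b := by
    ext v
    simp only [Finset.mem_inter, mem_inn, hmemW, Finset.mem_erase]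
    constructor
    · tauto
    · rintro ⟨h1, h2, h3⟩
      refine ⟨h3, ?_, h2, h1⟩
      rintro rfl
      exact T.asymm h3 hoO
  have hNWc : (T.inn x ∩ W).card + 2 = (T.inn x).card := by
    rw [hNW, Finset.card_erase_of_mem (by simp [hb, hab.symm]),
      Finset.card_erase_of_mem (by simpa using ha)]
    omega
  have key := h.sum_out_eq_sum_inn hW hxW hyW (fun v hv hvx => ?_) (by rw [hyN])
  · have e1 : ∀ n ∈ T.inn x ∩ W, (T.out n ∩ (W \ T.inn x)).card = A.card - 1 := by
      intro n hn
      rw [← Finset.card_erase_of_mem hoA]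
      congr 1
      rw [← hAn n (by simpa using (Finset.mem_inter.1 hn).1)]
      ext v
      simp only [Finset.mem_inter, Finset.mem_sdiff, mem_out, mem_inn, hmemW, Finset.mem_erase]
      constructor
      · tauto
      · rintro ⟨h1, h2, h3⟩
        refine ⟨h2, ⟨h1, ?_, ?_⟩, h3⟩
        · rintro rfl
          exact h3 ha
        · rintro rfl
          exact h3 hb
    have e2 : ∀ n ∈ T.inn x ∩ W, (T.inn n ∩ (W \ T.inn x)).card = A.card := by
      intro n hn
      have hn' : T.Adj n x := by simpa using (Finset.mem_inter.1 hn).1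
      rw [hAB, ← hBn n hn']
      congr 1
      ext v
      simp only [Finset.mem_inter, Finset.mem_sdiff, mem_inn, hmemW]
      constructor
      · tauto
      · rintro ⟨h2, h3⟩
        refine ⟨h2, ⟨?_, ?_, ?_⟩, h3⟩
        · rintro rfl
          exact T.asymm h2 (((hmemA _).1 hoA).2 n hn')
        · rintro rfl
          exact h3 ha
        · rintro rfl
          exact h3 hb
    rw [Finset.sum_congr rfl e1, Finset.sum_congr rfl e2, Finset.sum_const, Finset.sum_const,
      smul_eq_mul, smul_eq_mul] at key
    have := Nat.eq_of_mul_eq_mul_left (by omega) key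
    omega
  · by_cases hvN : T.Adj v x
    · have hsub : T.out v ∩ W ⊆ (T.inn x ∩ W).erase v ∪ A.erase o := by
        intro u hu
        simp only [Finset.mem_inter, mem_out] at hu
        simp only [Finset.mem_union, Finset.mem_erase, Finset.mem_inter, mem_inn]
        by_cases huN : T.Adj u x
        · exact Or.inl ⟨(T.ne_of_adj hu.1).symm, huN, hu.2⟩
        · refine Or.inr ⟨((hmemW u).1 hu.2).1, ?_⟩
          rw [← hAn v hvN]
          simpa using ⟨hu.1, huN⟩
      have h1 := (Finset.card_le_card hsub).trans (Finset.card_union_le _ _)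
      rw [Finset.card_erase_of_mem hoA, Finset.card_erase_of_mem (by simp [hvN, hv])] at h1
      omega
    · by_cases hvA : v ∈ A
      · have hxv : T.Adj x v := (mem_or_of_notMem_inn (by simpa using hvN)).resolve_left hvx
        have hsub : T.out v ∩ W ⊆ (T.out x ∩ W).erase v := by
          intro u hu
          simp only [Finset.mem_inter, mem_out] at hu
          simp only [Finset.mem_erase, Finset.mem_inter, mem_out]
          refine ⟨(T.ne_of_adj hu.1).symm, ?_, hu.2⟩
          have hux : u ≠ x := by
            rintro rfl
            exact T.asymm hxv hu.1
          exact (T.total hux).resolve_left fun h1 =>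
            T.asymm hu.1 (((hmemA v).1 hvA).2 u h1)
        have h1 := Finset.card_le_card hsub
        have h2 : v ∈ T.out x ∩ W := by simp [hxv, hv]
        rw [Finset.card_erase_of_mem h2] at h1
        have := Finset.card_pos.2 ⟨v, h2⟩
        omega
      · have hvB := hmemB v hvN hvA
        have hsub : T.out v ∩ W ⊆ (T.inn x ∩ W) ∪ B.erase v := by
          intro u hu
          simp only [Finset.mem_inter, mem_out] at hu
          simp only [Finset.mem_union, Finset.mem_erase, Finset.mem_inter, mem_inn]
          by_cases huN : T.Adj u x
          · exact Or.inl ⟨huN, hu.2⟩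
          · refine Or.inr ⟨(T.ne_of_adj hu.1).symm, hmemB u huN fun huA => ?_⟩
            exact T.asymm hu.1 (hT.adj_of_mem_sdiff ha huA hvB)
        have h1 := (Finset.card_le_card hsub).trans (Finset.card_union_le _ _)
        rw [Finset.card_erase_of_mem hvB] at h1
        omega

/-- A vertex of maximum out-degree has in-degree at most three. Otherwise all its in-neighbours halve
the remaining vertices: those strictly between the first one `a` and the last one `b` by
`card_eq_of_between`, and then `b` and `a` by deleting three others. -/
theorem IsMinusSelfDual.card_inn_le_three {V : Type*} [Fintype V]
    {T : Tournament V} (h : T.IsMinusSelfDual 3) (hT : T.IsLocallyTransitive) {x : V}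
    (hmax : ∀ v, (T.out v).card ≤ (T.out x).card) (hne : (T.out x).Nonempty) :
    (T.inn x).card ≤ 3 := by
  classical
  by_contra hl
  replace hl : 4 ≤ (T.inn x).card := by omega
  obtain ⟨a, b, ha, hb, hfa, hfb, hab⟩ := hT.exists_first_last (x := x) (by omega)
  have hinner : ∀ n, T.Adj n x → n ≠ a → n ≠ b →
      (T.out n \ T.inn x).card = (T.inn n \ T.inn x).card := fun n hn hna hnb =>
    h.card_eq_of_between hT hmax hne hl ha hn hb (hfa n hn hna) (hfb n hn hnb)
  -- `c` and `d` are the first and last of the vertices strictly between `a` and `b`.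
  have hNc : (((T.inn x).erase a).erase b).card + 2 = (T.inn x).card := by
    rw [Finset.card_erase_of_mem (by simp [hb, hab.symm]),
      Finset.card_erase_of_mem (by simpa using ha)]
    omega
  have htr : T.TransOn (((T.inn x).erase a).erase b) := (hT x).2.mono fun v hv => by
    simpa using Finset.mem_of_mem_erase (Finset.mem_of_mem_erase hv)
  obtain ⟨c, hc, hfc⟩ := htr.exists_first (Finset.card_pos.1 (by omega))
  obtain ⟨d, hd, hfd⟩ := htr.exists_last (Finset.card_pos.1 (by omega))
  have hcd : T.Adj c d := by
    refine hfc d hd ?_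
    rintro rfl
    obtain ⟨e, he, hed⟩ := Finset.exists_mem_ne (s := ((T.inn x).erase a).erase b) (by omega) d
    exact T.asymm (hfc e he hed) (hfd e he hed)
  simp only [Finset.mem_erase, mem_inn] at hc hd hfc hfd
  obtain ⟨hcb, hca, hcx⟩ := hc
  obtain ⟨hdb, hda, hdx⟩ := hd
  have hdb' : (T.out b \ T.inn x).card = (T.inn b \ T.inn x).card := by
    by_cases hbk : (T.out b).card = (T.out x).card
    · -- Here `b` has maximum out-degree too, and `c` is between two in-neighbours of `b`.
      exfalso
      obtain ⟨y, hxy, -, hyN⟩ := hT.exists_antipode hmax hne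
      have hy : ∀ n, T.Adj n x → T.Adj y n := fun n hn => by
        rw [← mem_out, hyN, mem_inn]
        exact hn
      have hout : T.out b = ((T.inn x)ᶜ).erase y := by
        refine Finset.eq_of_subset_of_card_le (fun v hv => ?_) ?_
        · rw [mem_out] at hv
          simp only [Finset.mem_erase, Finset.mem_compl, mem_inn]
          refine ⟨?_, fun h1 => ?_⟩
          · rintro rfl
            exact T.asymm hv (hy b hb)
          · exact T.asymm hv (hfb v h1 (T.ne_of_adj hv).symm)
        · rw [Finset.card_erase_of_mem (by simpa using T.asymm hxy), card_compl_inn, hbk]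
          rfl
      have h1 := T.card_out_add_card_inn x
      have h2 := T.card_out_add_card_inn b
      have h3 := h.card_eq_of_between hT (x := b) (fun v => by rw [hbk]; exact hmax v)
        (Finset.card_pos.1 (by rw [hbk]; exact Finset.card_pos.2 hne)) (by omega)
        (hy b hb) (hfb c hcx hcb) (hfb d hdx hdb) (hy c hcx) hcd
      have h4 := hinner c hcx hca hcb
      have h5 := T.card_out_sdiff_add hcx
      have h6 := T.card_out_sdiff_add (hfb c hcx hcb)
      have hsub : insert b (T.out c \ T.inn x) ⊆ T.out c \ T.inn b := by
        intro v hv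
        simp only [Finset.mem_insert, Finset.mem_sdiff, mem_out, mem_inn] at hv ⊢
        rcases hv with rfl | ⟨hv1, hv2⟩
        · exact ⟨hfb c hcx hcb, T.loopless _⟩
        · refine ⟨hv1, T.asymm ?_⟩
          rw [← mem_out, hout]
          simp only [Finset.mem_erase, Finset.mem_compl, mem_inn]
          refine ⟨?_, hv2⟩
          rintro rfl
          exact T.asymm hv1 (hy c hcx)
      have h7 := Finset.card_le_card hsub
      rw [Finset.card_insert_of_notMem (by simp [hb])] at h7
      omega
    · have h1 := h.sum_sdiff_eq_zero hT hmax hne (X := {a, c, d})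
        (by
          simp only [Finset.mem_insert, Finset.mem_singleton]
          rintro v (rfl | rfl | rfl)
          exacts [ha, hcx, hdx])
        (Finset.card_eq_three.2 ⟨a, c, d, hca.symm, hda.symm, T.ne_of_adj hcd, rfl⟩)
        (fun v hvx hv => by
          rcases T.total hvx with h2 | h2
          · by_cases hva : v = a
            · simp [hva]
            by_cases hvd : v = d
            · simp [hvd]
            · refine Or.inr ⟨d, by simp, hfd v ⟨?_, hva, h2⟩ hvd⟩
              rintro rfl
              exact hbk hv
          · exact Or.inr ⟨a, by simp, hT.adj_first ha hfa h2 hv⟩)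
      rw [Finset.sum_eq_single b] at h1
      · omega
      · intro n hn hnb
        simp only [Finset.mem_sdiff, mem_inn, Finset.mem_insert, Finset.mem_singleton,
          not_or] at hn
        rw [hinner n hn.1 hn.2.1 hnb]
        simp
      · intro hb'
        refine absurd ?_ hb'
        simp [hb, hab.symm, hcb.symm, hdb.symm]
  have hda' : (T.out a \ T.inn x).card = (T.inn a \ T.inn x).card := by
    have hwn : ∀ v, T.Adj x v → ¬ T.Adj v c → ∀ n, T.Adj n x → T.Adj v n → n = a := by
      intro v hxv hvc n hn hvn
      by_contra hna
      by_cases hnc : n = c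
      · rw [hnc] at hvn
        exact hvc hvn
      have hcn : T.Adj c n := by
        by_cases hnb : n = b
        · rw [hnb]
          exact hfb c hcx hcb
        · exact hfc n ⟨hnb, hna, hn⟩ hnc
      exact hvc (hT.adj_of_in hxv hcx hcn hvn hn)
    have h1 := h.sum_sdiff_eq_zero hT hmax hne (X := {b, c, d})
      (by
        simp only [Finset.mem_insert, Finset.mem_singleton]
        rintro v (rfl | rfl | rfl)
        exacts [hb, hcx, hdx])
      (Finset.card_eq_three.2 ⟨b, c, d, hcb.symm, hdb.symm, T.ne_of_adj hcd, rfl⟩)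
      (fun v hvx hv => by
        rcases T.total hvx with h2 | h2
        · by_cases hvb : v = b
          · simp [hvb]
          · exact Or.inr ⟨b, by simp, hfb v h2 hvb⟩
        · refine Or.inr ⟨c, by simp, ?_⟩
          -- Otherwise `v` has maximum out-degree, and `d` is between two in-neighbours of `v`.
          by_contra hvc
          have hin : ∀ n, T.Adj n x → n ≠ a → T.Adj n v := by
            intro n hn hna
            have hnv : n ≠ v := by
              rintro rfl
              exact T.asymm hn h2
            exact (T.total hnv).resolve_right fun h3 => hna (hwn v h2 hvc n hn h3)
          have h3 := T.card_out_add_card_inn x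
          have h4 := T.card_out_add_card_inn v
          have h5 := h.card_eq_of_between hT (x := v) (fun w => by rw [hv]; exact hmax w)
            (Finset.card_pos.1 (by rw [hv]; exact Finset.card_pos.2 hne)) (by omega)
            (hin c hcx hca) (hin d hdx hda) h2 hcd hdx
          have h6 := hinner d hdx hda hdb
          have h7 := T.card_out_sdiff_add hdx
          have h8 := T.card_out_sdiff_add (hin d hdx hda)
          have hsub : T.out d \ T.inn v ⊆ (T.out d \ T.inn x).erase x := by
            intro u hu
            simp only [Finset.mem_sdiff, mem_out] at hu
            simp only [Finset.mem_erase, Finset.mem_sdiff, mem_out, mem_inn]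
            refine ⟨?_, hu.1, fun hux => ?_⟩
            · rintro rfl
              exact hu.2 (by simpa using h2)
            · rcases mem_or_of_notMem_inn hu.2 with rfl | h9
              · exact T.asymm h2 hux
              · have := hwn v h2 hvc u hux h9
                subst this
                exact T.asymm hu.1 (hfa d hdx hda)
          have h9 := Finset.card_le_card hsub
          rw [Finset.card_erase_of_mem (self_mem_out_sdiff hdx)] at h9
          have := Finset.card_pos.2 ⟨x, self_mem_out_sdiff hdx⟩
          omega)
    rw [Finset.sum_eq_single a] at h1
    · omega
    · intro n hn hna
      simp only [Finset.mem_sdiff, mem_inn, Finset.mem_insert, Finset.mem_singleton,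
        not_or] at hn
      rw [hinner n hn.1 hna hn.2.1]
      simp
    · intro ha'
      refine absurd ?_ ha'
      simp [ha, hab, hca.symm, hda.symm]
  refine h.false_of_halving hT hmax hne hl fun n hn => ?_
  by_cases hna : n = a
  · rwa [hna]
  by_cases hnb : n = b
  · rwa [hnb]
  exact hinner n hn hna hnb

/-! ### Strong self duality of transitive and almost transitive tournaments -/

theorem IsTransitive.exists_reversal {V : Type*} [Finite V] {T : Tournament V}
    (hT : T.IsTransitive) : ∃ e : V ≃ V, ∀ u v, T.Adj (e v) (e u) ↔ T.Adj u v := by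
  classical
  have := Fintype.ofFinite V
  have : IsStrictTotalOrder V T.Adj :=
    { irrefl := T.loopless
      trans := hT
      trichotomous := fun u v h1 h2 => by
        by_contra hne
        exact (T.total hne).elim h1 h2 }
  let _ : LinearOrder V := linearOrderOfSTO T.Adj
  let o : Fin (Fintype.card V) ≃o V := Fintype.orderIsoFinOfCardEq V rfl
  refine ⟨o.symm.toEquiv.trans (Fin.revPerm.trans o.toEquiv), fun u v => ?_⟩
  change o (Fin.rev (o.symm v)) < o (Fin.rev (o.symm u)) ↔ u < v
  simp

theorem IsTransitive.induce {V : Type*} {T : Tournament V} (hT : T.IsTransitive) (X : Set V) :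
    (T.induce X).IsTransitive :=
  fun x y z => hT x y z

theorem IsTransitive.isStronglySelfDual {V : Type*} [Finite V] {T : Tournament V}
    (hT : T.IsTransitive) : T.IsStronglySelfDual := by
  intro X
  obtain ⟨e, he⟩ := (hT.induce X).exists_reversal
  exact ⟨⟨e, fun {u v} => he u v⟩⟩

theorem IsAlmostTransitive.isStronglySelfDual {V : Type*} [Fintype V] {T : Tournament V}
    (hT : T.IsAlmostTransitive) : T.IsStronglySelfDual := by
  obtain ⟨-, S, hS, a, b, ha, hb, rfl⟩ := hT
  intro X
  obtain ⟨e, he⟩ := (hS.induce X).exists_reversal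
  refine ⟨⟨e, fun {u v} => ?_⟩⟩
  have hadj : ∀ u v : X, S.Adj (e v) (e u) ↔ S.Adj u v := he
  change (S.reverseArc a b).Adj (e v) (e u) ↔ (S.reverseArc a b).Adj u v
  simp only [reverseArc]
  by_cases hX : a ∈ X ∧ b ∈ X
  · -- The reversal of `S[X]` exchanges its first vertex `a` and its last vertex `b`.
    have hea : e ⟨a, hX.1⟩ = ⟨b, hX.2⟩ := by
      by_contra hne
      have h1 : S.Adj (e ⟨a, hX.1⟩) (e (e.symm ⟨b, hX.2⟩)) := by
        rw [Equiv.apply_symm_apply]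
        exact hb _ fun h => hne (Subtype.ext h)
      rw [hadj] at h1
      exact S.asymm h1 (ha _ (S.ne_of_adj h1))
    have heb : e ⟨b, hX.2⟩ = ⟨a, hX.1⟩ := by
      by_contra hne
      have h1 : S.Adj (e (e.symm ⟨a, hX.1⟩)) (e ⟨b, hX.2⟩) := by
        rw [Equiv.apply_symm_apply]
        exact ha _ fun h => hne (Subtype.ext h)
      rw [hadj] at h1
      exact S.asymm h1 (hb _ (S.ne_of_adj h1).symm)
    have hea' : ∀ u : X, (e u : V) = b ↔ (u : V) = a := fun u => by
      rw [show ((u : V) = a) ↔ u = ⟨a, hX.1⟩ from by rw [Subtype.ext_iff],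
        show ((e u : V) = b) ↔ e u = ⟨b, hX.2⟩ from by rw [Subtype.ext_iff], ← hea,
        e.injective.eq_iff]
    have heb' : ∀ u : X, (e u : V) = a ↔ (u : V) = b := fun u => by
      rw [show ((u : V) = b) ↔ u = ⟨b, hX.2⟩ from by rw [Subtype.ext_iff],
        show ((e u : V) = a) ↔ e u = ⟨a, hX.1⟩ from by rw [Subtype.ext_iff], ← heb,
        e.injective.eq_iff]
    rw [hea', hea', heb', heb']
    have h1 := hadj u v
    have h2 := hadj v u
    split_ifs <;> tauto
  · have key : ∀ u v : X, ¬ (((u : V) = a ∧ (v : V) = b) ∨ ((u : V) = b ∧ (v : V) = a)) := by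
      rintro u v (⟨h1, h2⟩ | ⟨h1, h2⟩)
      · exact hX ⟨h1 ▸ u.2, h2 ▸ v.2⟩
      · exact hX ⟨h2 ▸ v.2, h1 ▸ u.2⟩
    rw [if_neg (key _ _), if_neg (key _ _)]
    exact hadj u v

theorem IsStronglySelfDual.isMinusSelfDual {V : Type*} {T : Tournament V}
    (hT : T.IsStronglySelfDual) (k : ℕ) : T.IsMinusSelfDual k :=
  fun X _ => hT (X : Set V)ᶜ

theorem IsMinusSelfDual.transitive_or_almostTransitive {V : Type*} [Fintype V] {T : Tournament V}
    (h : T.IsMinusSelfDual 3) (hn : 9 ≤ Fintype.card V) (hdec : T.IsDecomposable) :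
    T.IsTransitive ∨ T.IsAlmostTransitive := by
  obtain ⟨a, b, hab, htw⟩ := exists_twins h (by omega) hdec
  have hT := isLocallyTransitive_of_twins h (by omega) hab htw
  have : Nonempty V := ⟨a⟩
  obtain ⟨x, hmax⟩ := Finite.exists_max fun v => (T.out v).card
  have hne : (T.out x).Nonempty :=
    Finset.card_pos.1 ((Finset.card_pos.2 ⟨b, mem_out.2 hab⟩).trans_le (hmax a))
  exact transitive_or_almostTransitive_of_card_inn_le h hn hT hmax
    (h.card_inn_le_three hT hmax hne)

end Tournament

theorem theorem4 {V : Type*} [Fintype V] (T : Tournament V) (hcard : 9 ≤ Fintype.card V)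
    (hdec : T.IsDecomposable) :
    (T.IsMinusSelfDual 3 ↔ T.IsTransitive ∨ T.IsAlmostTransitive) ∧
      (T.IsMinusSelfDual 3 ↔ T.IsStronglySelfDual) := by
  have h1 : T.IsMinusSelfDual 3 → T.IsTransitive ∨ T.IsAlmostTransitive := fun h =>
    h.transitive_or_almostTransitive hcard hdec
  have h2 : T.IsTransitive ∨ T.IsAlmostTransitive → T.IsStronglySelfDual := fun h =>
    h.elim (fun h => h.isStronglySelfDual) fun h => h.isStronglySelfDual
  have h3 : T.IsStronglySelfDual → T.IsMinusSelfDual 3 := fun h => h.isMinusSelfDual 3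
  exact ⟨⟨h1, fun h => h3 (h2 h)⟩, fun h => h2 (h1 h), h3⟩
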